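/- Let $\mathbb F_q$ be a finite field with $q$ elements, let $C$ be a smooth projective geometrically irreducible curve over $\mathbb F_q$, let $\infty\in C(\mathbb F_q)$, and let $A=\Gamma(C\setminus\{\infty\},\mathcal O_C)$. Let $L$ be a field extension of $\mathbb F_q$, put $C_L=C\times_{\mathbb F_q}\operatorname{Spec}L$ and $A_L=A\otimes_{\mathbb F_q}L$, let $\sigma=\mathrm{id}_C\times\operatorname{Spec}(\mathrm{Frob}_q)$ be the endomorphism of $C_L$ that is the identity on $C$ and the $q$-Frobenius $x\mapsto x^q$ on $L$, and write $\sigma^*$ for pullback along $\sigma$ (on $A_L$: $a\otimes b\mapsto a\otimes b^q$, and $\sigma^*M=M\otimes_{A_L,\sigma^*}A_L$). Let $r,d,r',d'\ge 0$ denote integers. *Pure $A$-motives.* Let $c^*:A\to L$ be an $\mathbb F_q$-homomorphism and let $J\subset A_L$ be the ideal generated by all $a\otimes1-1\otimes c^*(a)$, $a\in A$. A pure $A$-motive $(M,\tau)$ of rank $r$, dimension $d$ and characteristic $c^*$ over $L$ is a locally free $A_L$-module $M$ of rank $r$ with an injective $A_L$-homomorphism $\tau:\sigma^*M\to M$ such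 that (1) $\operatorname{coker}\tau$ is an $L$-vector space of dimension $d$ annihilated by $J^d$, and (2) for some integers $k,l>0$, $M$ extends to a locally free sheaf $\mathcal M$ of rank $r$ on $C_L$ such that $\tau^l=\tau\circ\sigma^*(\tau)\circ\dots\circ(\sigma^*)^{l-1}(\tau):(\sigma^*)^lM\to M$ induces an isomorphism $(\sigma^*)^l\mathcal M_\infty\to\mathcal M(k\cdot\infty)_\infty$ of stalks at $\infty$. For $r>0$, the number $k/l$, for $k,l$ as in (2), is the weight of $(M,\tau)$. A morphism $(M,\tau)\to(M',\tau')$ of pure $A$-motives of the same characteristic $c^*$ is an $A_L$-homomorphism $f:M\to M'$ with $f\circ\tau=\tau'\circ\sigma^*f$. *Abelian $\tau$-sheaves.* Let $c:\operatorname{Spec}L\to C$ be an $\mathbb F_q$-morphism and let $\mathcal I\subset\mathcal O_{C_L}$ be the ideal sheaf of its graph. An abelian $\tau$-sheaf $\underline{\mathcal F}=(\mathcal F_i,\Pi_i,\tau_i)_{i\in\mathbb Z}$ of rank $r$, dimension $d$ and characteristic $c$ over $L$ consists of locally free sheaves $\mathcal F_i$ of rank $r$ on $C_L$ and injective $\mathcal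 O_{C_L}$-module morphisms $\Pi_i:\mathcal F_i\to\mathcal F_{i+1}$ and $\tau_i:\sigma^*\mathcal F_i\to\mathcal F_{i+1}$ such that (1) $\Pi_{i+1}\circ\tau_i=\tau_{i+1}\circ\sigma^*\Pi_i$ for all $i$; (2) there are integers $k,l>0$ with $ld=kr$ such that $\Pi_{i+l-1}\circ\dots\circ\Pi_i$ identifies $\mathcal F_i$ with the subsheaf $\mathcal F_{i+l}(-k\cdot\infty)$ of $\mathcal F_{i+l}$ for all $i$; (3) $\dim_L\operatorname{coker}\Pi_i=d$ for all $i$; (4) $\operatorname{coker}\tau_i$ is annihilated by $\mathcal I^d$ and $\dim_L\operatorname{coker}\tau_i=d$ for all $i$. Its weight is $d/r$ if $r>0$, and $0$ if $\underline{\mathcal F}$ is the zero sheaf ($r=0$). A morphism $f:\underline{\mathcal F}\to\underline{\mathcal F}'$ of abelian $\tau$-sheaves of the same characteristic $c$ is a family of morphisms $f_i:\mathcal F_i\to\mathcal F'_i$ with $f_{i+1}\circ\Pi_i=\Pi'_i\circ f_i$ and $f_{i+1}\circ\tau_i=\tau'_i\circ\sigma^*f_i$ for all $i$. Then the following hold.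 1. If $\underline M$ and $\underline M'$ are pure $A$-motives of the same characteristic (of possibly different ranks and dimensions) that have different weights, then the only morphism $\underline M\to\underline M'$ is zero. More precisely, if $k/l\neq k'/l'$ for some pairs $(k,l)$ and $(k',l')$ satisfying condition (2) for $\underline M$ and $\underline M'$ respectively, then $\operatorname{Hom}(\underline M,\underline M')=\{0\}$. 2. If $\underline{\mathcal F}$ and $\underline{\mathcal F}'$ are abelian $\tau$-sheaves of the same characteristic (of possibly different ranks and dimensions) and $\operatorname{Hom}(\underline{\mathcal F},\underline{\mathcal F}')\neq\{0\}$, then $\underline{\mathcal F}$ and $\underline{\mathcal F}'$ have the same weight. -/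

import Mathlib

open CategoryTheory AlgebraicGeometry TopologicalSpace
open scoped TensorProduct

universe u

noncomputable section

namespace PureMotive

/-! ### Generalities on sheaves of modules -/

section Generalities

variable {X : Scheme.{u}}

/-- The stalk `F_x` is a module over the local ring `𝒪_{X,x}`. -/
instance stalkModule (F : X.Modules) (x : X) :
    Module (X.presheaf.stalk x) (F.presheaf.stalk x) :=
  let G : PresheafOfModules.{u} (X.presheaf ⋙ forget₂ CommRingCat RingCat) := F.val
  inferInstanceAs (Module ↑(TopCat.Presheaf.stalk X.presheaf x)
    ↑(TopCat.Presheaf.stalk G.presheaf x))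

/-- `F` is locally free of rank `r`: every point has an open neighbourhood `U` with sections
`b₁, …, b_r` of `F` over `U` such that `𝒪_U^r → F|_U`, `a ↦ ∑ a_j b_j`, is an isomorphism. -/
def IsLocallyFreeOfRank (F : X.Modules) (r : ℕ) : Prop :=
  ∀ x : X, ∃ U : X.Opens, x ∈ U ∧ ∃ b : Fin r → Γ(F, U), ∀ (V : X.Opens) (h : V ≤ U),
    Function.Bijective fun a : Fin r → Γ(X, V) =>
      ∑ j, a j • (F.presheaf.map (homOfLE h).op).hom (b j)

/-- The endomorphism of the local ring at a fixed point `x` of `f : X ⟶ X` induced by `f`. -/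
def stalkEndo (f : X ⟶ X) (x : X) (h : f x = x) :
    X.presheaf.stalk x →+* X.presheaf.stalk x :=
  (X.presheaf.stalkSpecializes (specializes_of_eq h) ≫ f.stalkMap x).hom

/-- The dimension over a field `L` of a module over an `L`-algebra `R`. -/
def dimOver {L R : Type u} [Field L] [CommRing R] (φ : L →+* R) (N : ModuleCat.{u} R) : Cardinal :=
  Module.rank L ((ModuleCat.restrictScalars φ).obj N)

/-- The element `1 ⊗ m` of `S ⊗_R M`, for a ring homomorphism `f : R → S`. -/
def oneTmul {R S : Type u} [CommRing R] [CommRing S] (f : R →+* S) (M : ModuleCat.{u} R) (m : M) :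
    (ModuleCat.extendScalars f).obj M :=
  ((ModuleCat.extendRestrictScalarsAdj f).unit.app M).hom m

/-- The ideal sheaf `I` satisfies `I ^ d · F = 0`. -/
def IsAnnihilatedByPow (I : X.IdealSheafData) (d : ℕ) (F : X.Modules) : Prop :=
  ∀ U : X.affineOpens, ∀ a ∈ I.ideal U ^ d, ∀ s : Γ(F, U.1), a • s = 0

/-- The image of `f : F ⟶ G` is the subsheaf `I ^ k · G` of `G`. -/
def HasImagePowMul (I : X.IdealSheafData) (k : ℕ) {F G : X.Modules} (f : F ⟶ G) : Prop :=
  ∀ U : X.affineOpens, ∀ s : Γ(G, U.1),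
    s ∈ Set.range (f.app U.1).hom ↔
      s ∈ (I.ideal U ^ k • (⊤ : Submodule Γ(X, U.1) Γ(G, U.1)))

end Generalities

/-! ### The curve and its base change -/

/-- A smooth projective geometrically irreducible curve `C` over `k` with a `k`-rational point `∞`.
(For curves over a field, proper is the same as projective.) -/
structure PointedCurve (k : Type u) [Field k] where
  C : Scheme.{u}
  π : C ⟶ Spec (.of k)
  smooth : SmoothOfRelativeDimension 1 π
  proper : IsProper π
  geomIrred : GeometricallyIrreducible π
  pt : Spec (.of k) ⟶ C
  pt_π : pt ≫ π = 𝟙 _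

namespace PointedCurve

attribute [instance] smooth proper geomIrred

variable {k : Type u} [Field k] (X : PointedCurve k)

/-- The open subscheme `C ∖ {∞}`. -/
def affinePart : X.C.Opens := X.pt.ker.support.compl

/-- `A = Γ(C ∖ {∞}, 𝒪_C)`. -/
abbrev A : Type u := Γ(X.C, X.affinePart)

instance algebraA : Algebra k X.A :=
  ((Scheme.ΓSpecIso (.of k)).inv ≫ X.π.appTop ≫
    X.C.presheaf.map (homOfLE le_top).op).hom.toAlgebra

variable (L : Type u) [Field L] [Algebra k L]

/-- `C_L = C ×_{Spec k} Spec L`. -/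
abbrev CL : Scheme.{u} := Limits.pullback X.π (Spec.map (CommRingCat.ofHom (algebraMap k L)))

/-- The projection `C_L ⟶ C`. -/
abbrev pr₁ : X.CL L ⟶ X.C := Limits.pullback.fst _ _

/-- The projection `C_L ⟶ Spec L`. -/
abbrev pr₂ : X.CL L ⟶ Spec (.of L) := Limits.pullback.snd _ _

/-- `A_L = A ⊗_k L`. -/
abbrev AL : Type u := X.A ⊗[k] L

/-- `C_L ∖ {∞}`. -/
abbrev affinePartL : (X.CL L).Opens := X.pr₁ L ⁻¹ᵁ X.affinePart

/-- The structure map `L → Γ(V, 𝒪_{C_L})`. -/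
def scalars (V : (X.CL L).Opens) : L →+* Γ(X.CL L, V) :=
  ((Scheme.ΓSpecIso (.of L)).inv ≫ (X.pr₂ L).appTop ≫
    (X.CL L).presheaf.map (homOfLE le_top).op).hom

variable {L}

/-- The canonical map `A_L → Γ(V, 𝒪_{C_L})` for `V ⊆ C_L ∖ {∞}`. -/
def toSections (V : (X.CL L).Opens) (hV : V ≤ X.affinePartL L) : X.AL L →+* Γ(X.CL L, V) :=
  letI : Algebra k Γ(X.CL L, V) := ((X.scalars L V).comp (algebraMap k L)).toAlgebra
  (Algebra.TensorProduct.lift (S := k)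
    (AlgHom.mk ((X.pr₁ L).appLE X.affinePart V hV).hom (by
      intro a
      have h : ((Scheme.ΓSpecIso (.of k)).inv ≫ X.π.appTop ≫
            X.C.presheaf.map (homOfLE le_top).op) ≫ (X.pr₁ L).appLE X.affinePart V hV =
          CommRingCat.ofHom (algebraMap k L) ≫ (Scheme.ΓSpecIso (.of L)).inv ≫
            (X.pr₂ L).appTop ≫ (X.CL L).presheaf.map (homOfLE le_top).op := by
        rw [Scheme.ΓSpecIso_inv_naturality_assoc, Category.assoc, Category.assoc,
          Scheme.Hom.map_appLE, Scheme.Hom.appLE]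
        have h0 : X.π.appTop ≫ (X.pr₁ L).appTop =
            (Spec.map (CommRingCat.ofHom (algebraMap k L))).appTop ≫ (X.pr₂ L).appTop := by
          rw [← Scheme.Hom.comp_appTop, ← Scheme.Hom.comp_appTop, Limits.pullback.condition]
        exact congr((Scheme.ΓSpecIso (.of k)).inv ≫ $((reassoc_of% h0)
          ((X.CL L).presheaf.map (homOfLE (le_top (a := V))).op)))
      exact congr($(h).hom a)) : X.A →ₐ[k] Γ(X.CL L, V))
    (AlgHom.mk (X.scalars L V) (fun _ => rfl) : L →ₐ[k] Γ(X.CL L, V))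
    (fun _ _ => Commute.all _ _)).toRingHom

/-- The graph `Spec L ⟶ C_L` of a `k`-morphism `c : Spec L ⟶ C`. -/
def graph (c : Spec (.of L) ⟶ X.C)
    (hc : c ≫ X.π = Spec.map (CommRingCat.ofHom (algebraMap k L))) : Spec (.of L) ⟶ X.CL L :=
  Limits.pullback.lift c (𝟙 _) (by simpa using hc)

variable (L) in
/-- The section `∞ × Spec L : Spec L ⟶ C_L`. -/
def ptL : Spec (.of L) ⟶ X.CL L :=
  X.graph (Spec.map (CommRingCat.ofHom (algebraMap k L)) ≫ X.pt) (by simp [X.pt_π])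

variable (L) in
/-- The point `∞` of `C_L`. -/
def inftyL : X.CL L := X.ptL L (IsLocalRing.closedPoint L)

instance irreducibleCL : IrreducibleSpace (X.CL L) :=
  GeometricallyIrreducible.irreducibleSpace_of_subsingleton (X.pr₂ L)

section Frobenius

variable [Finite k]

variable (k L) in
/-- The `q`-Frobenius `x ↦ x ^ q` of `L`, where `q` is the cardinality of `k`. -/
def frob : L →ₐ[k] L :=
  letI := Fintype.ofFinite k
  FiniteField.frobeniusAlgHom k L

variable (k L) in
lemma frob_comp : Spec.map (CommRingCat.ofHom (frob k L).toRingHom) ≫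
    Spec.map (CommRingCat.ofHom (algebraMap k L)) =
      Spec.map (CommRingCat.ofHom (algebraMap k L)) := by
  rw [← Spec.map_comp, ← CommRingCat.ofHom_comp]
  congr 2
  exact (frob k L).comp_algebraMap

variable (L) in
/-- `σ = id_C × Spec(Frob_q) : C_L ⟶ C_L`. -/
def σ : X.CL L ⟶ X.CL L :=
  Limits.pullback.map _ _ _ _ (𝟙 _) (Spec.map (CommRingCat.ofHom (frob k L).toRingHom)) (𝟙 _)
    (by simp) (by rw [Category.comp_id, frob_comp])

variable (L) in
/-- `σ^* : A_L → A_L`, `a ⊗ b ↦ a ⊗ b ^ q`. -/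
def σA : X.AL L →+* X.AL L :=
  (Algebra.TensorProduct.map (AlgHom.id k X.A) (frob k L)).toRingHom

lemma σ_inftyL : X.σ L (X.inftyL L) = X.inftyL L := by
  have h : X.ptL L ≫ X.σ L =
      Spec.map (CommRingCat.ofHom (frob k L).toRingHom) ≫ X.ptL L := by
    apply Limits.pullback.hom_ext
    · simp only [ptL, graph, σ, Limits.pullback.map, Category.assoc, Limits.pullback.lift_fst,
        Category.comp_id]
      rw [reassoc_of% frob_comp k L]
    · simp only [ptL, graph, σ, Limits.pullback.map, Category.assoc, Limits.pullback.lift_snd,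
        Limits.pullback.lift_snd_assoc, Category.comp_id, Category.id_comp]
  have h2 : X.σ L (X.ptL L (IsLocalRing.closedPoint L)) = X.ptL L
      (Spec.map (CommRingCat.ofHom (frob k L).toRingHom) (IsLocalRing.closedPoint L)) := by
    exact congr($h (IsLocalRing.closedPoint L))
  rw [inftyL, h2]
  congr 1
  exact Subsingleton.elim (α := PrimeSpectrum L) _ _

lemma σ_genericPoint : X.σ L (genericPoint (X.CL L)) = genericPoint (X.CL L) := by
  have hs : Surjective (X.σ L) := by
    have : Surjective (Spec.map (CommRingCat.ofHom (frob k L).toRingHom)) := ⟨fun y =>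
      ⟨IsLocalRing.closedPoint L, Subsingleton.elim (α := PrimeSpectrum L) _ _⟩⟩
    have hc : MorphismProperty.IsStableUnderComposition @Surjective.{u} :=
      ⟨fun _ _ hf hg => ⟨hg.1.comp hf.1⟩⟩
    exact MorphismProperty.pullbackMap (P := @Surjective.{u})
      (show Surjective (𝟙 X.C) from inferInstance) this (by simp)
      (frob_comp k L).symm
  have h := (genericPoint_spec (X.CL L)).image (X.σ L).continuous
  rw [Set.image_univ, hs.surj.range_eq] at h
  exact h.eq (by simpa using genericPoint_spec (X.CL L))

end Frobenius

end PointedCurve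

variable {k : Type u} [Field k] (X : PointedCurve k) {L : Type u} [Field L] [Algebra k L]

/-! ### Pure `A`-motives -/

/-- The ideal `J ⊆ A_L` generated by `a ⊗ 1 - 1 ⊗ c^*(a)` for `a ∈ A`. -/
def idealJ (c : X.A →ₐ[k] L) : Ideal (X.AL L) :=
  Ideal.span (Set.range fun a : X.A => a ⊗ₜ[k] (1 : L) - (1 : X.A) ⊗ₜ[k] c a)

/-- The identification `e` of `M` with the sections of `F` over `C_L ∖ {∞} = Spec A_L` makes `F`
an extension of `M` to `C_L`: it is `A_L`-linear and the restriction of `F` to `C_L ∖ {∞}` is the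
sheaf associated with `M`, that is, `Γ(V, 𝒪) ⊗_{A_L} M → Γ(V, F)` is bijective for all affine open
`V ⊆ C_L ∖ {∞}`. -/
def IsExtension (M : ModuleCat.{u} (X.AL L)) (F : (X.CL L).Modules)
    (e : M ≃+ Γ(F, X.affinePartL L)) : Prop :=
  (∀ (a : X.AL L) (m : M), e (a • m) = X.toSections (X.affinePartL L) le_rfl a • e m) ∧
  ∀ (V : (X.CL L).Opens) (hV : V ≤ X.affinePartL L), IsAffineOpen V →
    ∃ θ : (ModuleCat.extendScalars (X.toSections V hV)).obj M ≃+ Γ(F, V),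
      ∀ (b : Γ(X.CL L, V)) (m : M), θ (b • oneTmul (X.toSections V hV) M m) =
        b • (F.presheaf.map (homOfLE hV).op).hom (e m)

variable (L) in
/-- The generic point `η` of `C_L`. -/
abbrev eta : X.CL L := genericPoint (X.CL L)

variable (L) in
lemma eta_specializes : eta X L ⤳ X.inftyL L :=
  (genericPoint_spec (X.CL L)).specializes trivial

variable (L) in
/-- The inclusion of the local ring at `∞` into the function field of `C_L`. -/
def toGeneric : (X.CL L).presheaf.stalk (X.inftyL L) →+* (X.CL L).presheaf.stalk (eta X L) :=
  ((X.CL L).presheaf.stalkSpecializes (eta_specializes X L)).hom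

/-- The map from the stalk of `F` at `∞` to the generic stalk `F_η`. -/
def stalkToGeneric (F : (X.CL L).Modules) :
    F.presheaf.stalk (X.inftyL L) →+ F.presheaf.stalk (eta X L) :=
  (F.presheaf.stalkSpecializes (eta_specializes X L)).hom

/-- The stalk `F(n · ∞)_∞` as a subgroup of the generic stalk `F_η`: the elements `y` with
`𝔪^n y ⊆ F_∞`, where `𝔪` is the maximal ideal of the local ring of `C_L` at `∞`. -/
def twistedStalk (F : (X.CL L).Modules) (n : ℕ) : AddSubgroup (F.presheaf.stalk (eta X L)) where
  carrier := {y | ∀ a ∈ IsLocalRing.maximalIdeal ((X.CL L).presheaf.stalk (X.inftyL L)) ^ n,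
    toGeneric X L a • y ∈ (stalkToGeneric X F).range}
  zero_mem' a _ := by rw [smul_zero]; exact zero_mem _
  add_mem' h₁ h₂ a ha := by rw [smul_add]; exact add_mem (h₁ a ha) (h₂ a ha)
  neg_mem' h a ha := by rw [smul_neg]; exact neg_mem (h a ha)

variable [Finite k]

/-- The `σ^*`-semilinear map `m ↦ τ(1 ⊗ m)` given by an `A_L`-linear map `τ : σ^* M ⟶ M`. -/
def semilin {M : ModuleCat.{u} (X.AL L)}
    (τ : (ModuleCat.extendScalars (X.σA L)).obj M ⟶ M) (m : M) : M :=
  τ.hom (oneTmul (X.σA L) M m)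

/-- The purity condition for the pair `(n, l)`: `M` extends to a locally free sheaf `F` of rank `r`
on `C_L` such that `τ^l : (σ^*)^l M → M` induces an isomorphism of stalks
`(σ^*)^l F_∞ → F(n · ∞)_∞`. Here `T` is the extension of the semilinear map `m ↦ τ(1 ⊗ m)` to the
generic stalk `F_η`, which determines it uniquely, and
`(σ^*)^l F_∞ = 𝒪_{C_L,∞} ⊗_{(σ^*)^l, 𝒪_{C_L,∞}} F_∞`. -/
def IsPurePair (M : ModuleCat.{u} (X.AL L))
    (τ : (ModuleCat.extendScalars (X.σA L)).obj M ⟶ M) (r n l : ℕ) : Prop :=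
  0 < n ∧ 0 < l ∧
  ∃ (F : (X.CL L).Modules) (e : M ≃+ Γ(F, X.affinePartL L)),
    IsLocallyFreeOfRank F r ∧ IsExtension X M F e ∧
    ∃ T : F.presheaf.stalk (eta X L) →+ F.presheaf.stalk (eta X L),
      (∀ (a : (X.CL L).presheaf.stalk (eta X L)) (y : F.presheaf.stalk (eta X L)),
        T (a • y) = stalkEndo (X.σ L) (eta X L) X.σ_genericPoint a • T y) ∧
      (∀ (hη : eta X L ∈ X.affinePartL L) (m : M),
        T ((F.presheaf.germ _ _ hη).hom (e m)) =
          (F.presheaf.germ _ _ hη).hom (e (semilin X τ m))) ∧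
      ∃ θ : (ModuleCat.extendScalars (stalkEndo (X.σ L) (X.inftyL L) X.σ_inftyL ^ l)).obj
            (ModuleCat.of _ (F.presheaf.stalk (X.inftyL L))) ≃+ twistedStalk X F n,
        ∀ (b : (X.CL L).presheaf.stalk (X.inftyL L)) (x : F.presheaf.stalk (X.inftyL L)),
          (θ (b • oneTmul (stalkEndo (X.σ L) (X.inftyL L) X.σ_inftyL ^ l) (ModuleCat.of _ _) x) :
              F.presheaf.stalk (eta X L)) =
            toGeneric X L b • T^[l] (stalkToGeneric X F x)

/-- A pure `A`-motive `(M, τ)` of rank `r`, dimension `d` and characteristic `c^*` over `L`. -/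
structure PureAMotive (c : X.A →ₐ[k] L) (r d : ℕ) where
  M : ModuleCat.{u} (X.AL L)
  τ : (ModuleCat.extendScalars (X.σA L)).obj M ⟶ M
  finite : Module.Finite (X.AL L) M
  projective : Module.Projective (X.AL L) M
  rank_eq : ∀ p : PrimeSpectrum (X.AL L), Module.rankAtStalk (R := X.AL L) M p = r
  τ_injective : Function.Injective τ.hom
  coker_dim : dimOver (Algebra.TensorProduct.includeRight : L →ₐ[k] X.AL L).toRingHom
    (ModuleCat.of (X.AL L) (M ⧸ LinearMap.range τ.hom)) = d
  coker_annihilated : ∀ a ∈ idealJ X c ^ d, ∀ m : M, a • m ∈ LinearMap.range τ.hom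
  pure : ∃ n l : ℕ, IsPurePair X M τ r n l

namespace PureAMotive

variable {X} {c : X.A →ₐ[k] L} {r d r' d' : ℕ}

/-- `w` is the weight of `(M, τ)`: it is `n / l` for integers `n, l > 0` as in the purity
condition. -/
def IsWeight (N : PureAMotive X c r d) (w : ℚ) : Prop :=
  ∃ n l : ℕ, IsPurePair X N.M N.τ r n l ∧ w = n / l

/-- A morphism of pure `A`-motives: an `A_L`-linear map `f` with `f ∘ τ = τ' ∘ σ^* f`. -/
structure Hom (N : PureAMotive X c r d) (N' : PureAMotive X c r' d') where
  map : N.M ⟶ N'.M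
  comm : N.τ ≫ map = (ModuleCat.extendScalars (X.σA L)).map map ≫ N'.τ

end PureAMotive

/-! ### Abelian `τ`-sheaves -/

/-- The index `i + n`, by recursion on `n`. -/
def shift (i : ℤ) : ℕ → ℤ
  | 0 => i
  | n + 1 => shift i n + 1

/-- The composite `Π_{i+n-1} ∘ ⋯ ∘ Π_i : F_i ⟶ F_{i+n}`. -/
def chain {Y : Scheme.{u}} {F : ℤ → Y.Modules} (P : ∀ i, F i ⟶ F (i + 1)) (i : ℤ) :
    ∀ n : ℕ, F i ⟶ F (shift i n)
  | 0 => 𝟙 _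
  | n + 1 => chain P i n ≫ P (shift i n)

/-- An abelian `τ`-sheaf of rank `r`, dimension `d` and characteristic `c : Spec L ⟶ C` over `L`. -/
structure AbelianTauSheaf (c : Spec (.of L) ⟶ X.C)
    (hc : c ≫ X.π = Spec.map (CommRingCat.ofHom (algebraMap k L))) (r d : ℕ) where
  F : ℤ → (X.CL L).Modules
  P : ∀ i, F i ⟶ F (i + 1)
  τ : ∀ i, (Scheme.Modules.pullback (X.σ L)).obj (F i) ⟶ F (i + 1)
  locallyFree : ∀ i, IsLocallyFreeOfRank (F i) r
  P_injective : ∀ i, Mono (P i)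
  τ_injective : ∀ i, Mono (τ i)
  comm : ∀ i, τ i ≫ P (i + 1) = (Scheme.Modules.pullback (X.σ L)).map (P i) ≫ τ (i + 1)
  periodic : ∃ n l : ℕ, 0 < n ∧ 0 < l ∧ l * d = n * r ∧
    ∀ i, HasImagePowMul (X.ptL L).ker n (chain P i l)
  coker_P_dim : ∀ i, dimOver (X.scalars L ⊤)
    (ModuleCat.of Γ(X.CL L, ⊤) Γ(Limits.cokernel (P i), ⊤)) = d
  coker_τ_annihilated : ∀ i, IsAnnihilatedByPow (X.graph c hc).ker d (Limits.cokernel (τ i))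
  coker_τ_dim : ∀ i, dimOver (X.scalars L ⊤)
    (ModuleCat.of Γ(X.CL L, ⊤) Γ(Limits.cokernel (τ i), ⊤)) = d

namespace AbelianTauSheaf

variable {X} {c : Spec (.of L) ⟶ X.C}
  {hc : c ≫ X.π = Spec.map (CommRingCat.ofHom (algebraMap k L))} {r d r' d' : ℕ}

/-- The weight of an abelian `τ`-sheaf: `d / r`, and `0` for the zero sheaf (the case `r = 0`). -/
def weight (_ : AbelianTauSheaf X c hc r d) : ℚ :=
  if r = 0 then 0 else d / r

/-- A morphism of abelian `τ`-sheaves: maps `f_i : F_i ⟶ F'_i` commuting with the `Π`'s and the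
`τ`'s. -/
structure Hom (S : AbelianTauSheaf X c hc r d) (S' : AbelianTauSheaf X c hc r' d') where
  map : ∀ i, S.F i ⟶ S'.F i
  comm_P : ∀ i, S.P i ≫ map (i + 1) = map i ≫ S'.P i
  comm_τ : ∀ i, S.τ i ≫ map (i + 1) = (Scheme.Modules.pullback (X.σ L)).map (map i) ≫ S'.τ i

end AbelianTauSheaf

end PureMotive

end

/-! Motives. On an integral scheme a section of a locally free sheaf is determined by its generic
germ, so a nonzero morphism induces a nonzero linear map g : V → V' of the generic stalks of the two
extensions, commuting with the semilinear maps T and T'. The stalks at ∞ are lattices Λ, Λ' in V, V'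
over the local ring at ∞, a discrete valuation ring. Fix a uniformizer π there with σ^*π = π. For
exponents (n, l), purity says that π^n T^l maps Λ into itself and that its image spans Λ. Since σ^*
is a local homomorphism on the local ring, the corresponding map on Λ' is also injective modulo π:
if it sends x into πΛ', then x lies in πΛ'.

Bring both sides to the same iterate: Ψ = (π^n T^l)^{l'} = π^{nl'} T^{ll'} and Ψ' = π^{n'l}
T'^{ll'}, so that π^{nl'} Ψ'g = π^{n'l} gΨ. Rescale g by a power of π so that gΛ lies in Λ' but not
in πΛ'. If nl' < n'l, then Ψ' kills gΛ modulo π, hence gΛ ⊆ πΛ' by injectivity. If nl' > n'l, then g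
maps ΨΛ into πΛ', hence also Λ, which ΨΛ spans. Both are absurd, so nl' = n'l. This is
`exponent_eq_of_lattice_hom`, applied in `Lattice.slope_eq` and `IsPurePair.mul_eq_mul`.

Geometry. C_L is smooth over L, hence reduced, and irreducible, hence integral; at the rational
point ∞ the conormal module is free of rank one, so the local ring is a discrete valuation ring
(`isDiscreteValuationRing_stalk`). Its maximal ideal is generated by functions pulled back from C,
and one of these is already a uniformizer; it is σ-invariant because σ is the identity on C
(`nonempty_uniformizer`).

τ-sheaves. Let I be the ideal of ∞. The ll'e-fold composites of the Π's have image I^{nl'e} on the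
source and I^{n'le} on the target. Commuting f with these composites gives either I^{nl'e} f(F_i) ⊆
I^{n'le} F'_i or f(F_i) ⊆ I^{(nl'-n'l)e} F'_i for every e, according to which exponent is larger.
Letting e grow forces f = 0 near ∞, hence everywhere (`hom_eq_zero_of_periodic`). Finally ld = nr
identifies n/l with the weight d/r. -/

noncomputable section

namespace PureMotive

/-! ### Smooth algebras: reducedness, and the conormal module of a section -/

section Algebra

open Polynomial in
/-- A smooth algebra over a field is reduced: the formation of integral closures commutes with
smooth base change, and a nilpotent `s` makes `s ⊗ X` integral over `S` in `S ⊗ K[X]`. -/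
theorem isReduced_of_smooth (K S : Type*) [Field K] [CommRing S] [Algebra K S]
    [Algebra.Smooth K S] : IsReduced S := by
  refine ⟨fun s hs => ?_⟩
  have hint : IsIntegral S (s ⊗ₜ[K] (X : K[X])) := by
    obtain ⟨n, hn⟩ := hs
    refine ⟨X ^ (n + 1), monic_X_pow _, ?_⟩
    simp [Algebra.TensorProduct.tmul_pow, pow_succ, hn]
  obtain ⟨z, hz⟩ := (TensorProduct.toIntegralClosure_bijective_of_smooth
    (R := K) (S := S) (B := K[X])).2 ⟨_, hint⟩
  have hz' : Algebra.TensorProduct.map (.id S S) (integralClosure K K[X]).val z =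
      s ⊗ₜ[K] (X : K[X]) := congrArg Subtype.val hz
  -- Elements of K[X] integral over K are constants, so taking the coefficient of X kills the image
  -- of S ⊗ integralClosure, while it sends s ⊗ X to s.
  have hconst : ∀ p : integralClosure K K[X], (p : K[X]).coeff 1 = 0 := by
    rintro ⟨p, hp⟩
    obtain ⟨g, hg, hgp⟩ := hp
    by_contra hne
    have hdeg : p.natDegree ≠ 0 := fun h0 =>
      hne (coeff_eq_zero_of_natDegree_lt (by simp [h0]))
    have hcomp : g.comp p = 0 := by
      rw [comp, ← Polynomial.algebraMap_eq, hgp]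
    rw [comp_eq_zero_iff] at hcomp
    rcases hcomp with h | ⟨-, h⟩
    · exact hg.ne_zero h
    · exact hdeg (by rw [h, natDegree_C])
  let φ : S ⊗[K] K[X] →ₗ[S] S ⊗[K] K := (lcoeff K 1).baseChange S
  have hφ : φ (Algebra.TensorProduct.map (.id S S) (integralClosure K K[X]).val z) = 0 := by
    induction z with
    | zero => simp
    | add x y hx hy =>
      have : ∀ w, φ (Algebra.TensorProduct.map (.id S S) (integralClosure K K[X]).val w) = 0 := by
        intro w
        induction w with
        | zero => simp
        | add x y hx hy => rw [map_add, map_add, hx, hy, add_zero]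
        | tmul a p => simp [φ, hconst p]
      exact this _
    | tmul a p => simp [φ, hconst p]
  rw [hz'] at hφ
  have h2 : s ⊗ₜ[K] (1 : K) = 0 := by simpa [φ] using hφ
  have h3 := congrArg (TensorProduct.rid K S) h2
  simpa using h3

/-- The kernel of a section of a standard smooth algebra of relative dimension one is nonzero and
generated by one element modulo its square. -/
theorem exists_mem_ker_section_of_standardSmooth {R B : Type u} [CommRing R] [CommRing B]
    [Nontrivial R] (f : R →+* B) (ε : B →+* R) (h : ε.comp f = RingHom.id R)
    (hf : f.IsStandardSmoothOfRelativeDimension 1) :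
    RingHom.ker ε ≠ ⊥ ∧
      ∃ t ∈ RingHom.ker ε, ∀ x ∈ RingHom.ker ε, ∃ b : B, x - b * t ∈ RingHom.ker ε ^ 2 := by
  let := f.toAlgebra
  let := ε.toAlgebra
  have : Algebra.IsStandardSmoothOfRelativeDimension 1 R B := hf
  have : Algebra.IsStandardSmooth R B := hf.isStandardSmooth
  have : IsScalarTower R B R := .of_algebraMap_eq fun r => by
    exact (congr($h r)).symm
  have : Nontrivial B := ε.domain_nontrivial
  have hsurj : Function.Surjective (algebraMap B R) := fun r => ⟨f r, congr($h r)⟩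
  have hrank := Algebra.IsStandardSmoothOfRelativeDimension.rank_kaehlerDifferential
    (R := R) (S := B) 1
  obtain ⟨b⟩ : Nonempty (Module.Basis Unit B (Ω[B⁄R])) :=
    (finrank_eq_one_iff Unit).1 (Module.finrank_eq_of_rank_eq (by simpa using hrank))
  -- Smoothness of R over itself gives injectivity, Ω[R/R] = 0 gives surjectivity; so ker ε / (ker
  -- ε)² is R ⊗ Ω[B/R], free of rank one.
  have hinj : Function.Injective (KaehlerDifferential.kerCotangentToTensor R B R) :=
    (Algebra.FormallySmooth.kerCotangentToTensor_injective_iff hsurj).2 inferInstance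
  have hsur : Function.Surjective (KaehlerDifferential.kerCotangentToTensor R B R) := fun y =>
    (KaehlerDifferential.exact_kerCotangentToTensor_mapBaseChange R B R hsurj y).1
      (Subsingleton.elim _ _)
  let β : Module.Basis Unit R (R ⊗[B] Ω[B⁄R]) := b.baseChange R
  constructor
  · intro hbot
    obtain ⟨x, hx⟩ := hsur (β ())
    obtain ⟨⟨x, hx'⟩, rfl⟩ := Ideal.toCotangent_surjective _ x
    have hx0 : x = 0 := by
      have : x ∈ RingHom.ker ε := hx'
      rwa [hbot] at this
    subst hx0
    apply β.ne_zero ()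
    rw [← hx, KaehlerDifferential.kerCotangentToTensor_toCotangent]
    simp
  · obtain ⟨t, ht⟩ := hsur (β ())
    obtain ⟨t, rfl⟩ := Ideal.toCotangent_surjective _ t
    refine ⟨t.1, t.2, fun x hx => ?_⟩
    let x' : RingHom.ker (algebraMap B R) := ⟨x, hx⟩
    set c := β.repr (KaehlerDifferential.kerCotangentToTensor R B R
      (Ideal.toCotangent _ x')) () with hc
    have hxc : KaehlerDifferential.kerCotangentToTensor R B R (Ideal.toCotangent _ x') =
        c • β () := by
      conv_lhs => rw [← β.sum_repr (KaehlerDifferential.kerCotangentToTensor R B R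
        (Ideal.toCotangent _ x'))]
      simp [hc]
    -- The coordinate c lies in R; since ε ∘ f = id, f c is a lift of it to B.
    refine ⟨f c, ?_⟩
    have hcf : algebraMap B R (f c) = c := congr($h c)
    have h0 : KaehlerDifferential.kerCotangentToTensor R B R
        (Ideal.toCotangent _ (x' - f c • t)) = 0 := by
      rw [map_sub, map_sub, LinearMap.map_smul, LinearMap.map_smul, hxc, ht, sub_eq_zero]
      conv_lhs => rw [← hcf]
      rw [algebraMap_smul]
    have h1 := hinj (h0.trans (map_zero _).symm)
    rw [Ideal.toCotangent_eq_zero] at h1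
    exact h1

end Algebra

/-! ### Semilinear comparison of two lattices -/

section Lattice

variable {K V V' : Type*} [CommRing K] [AddCommGroup V] [Module K V] [AddCommGroup V']
  [Module K V'] {S : Subring K}

/-- A linear map between two spaces with lattices `L`, `L'` and semilinear endomorphisms `Ψ`, `Ψ'`
such that `Ψ L` spans `L` and `Ψ'` is injective modulo `π`, which intertwines `Ψ` and `Ψ'` up to
distinct powers of `π`, vanishes. -/
theorem exponent_eq_of_lattice_hom {L : Submodule S V} {L' : Submodule S V'} {π ϖ : K}
    (hπ : π ∈ S) (hϖ : ϖ * π = 1) (f : V →ₗ[K] V') {Ψ : V → V} {Ψ' : V' → V'}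
    (hgen : ∀ g : V →ₗ[K] V', (∀ x ∈ L, g x = 0) → g = 0)
    (hbdd : ∃ N : ℕ, ∀ x ∈ L, π ^ N • f x ∈ L')
    (hsep : ∀ y : V', (∀ e : ℕ, ∃ z ∈ L', y = π ^ e • z) → y = 0)
    (hΨ : ∀ x ∈ L, Ψ x ∈ L) (hspan : L ≤ Submodule.span S (Ψ '' L))
    (hinj : ∀ x ∈ L', (∃ z ∈ L', Ψ' x = π • z) → ∃ z ∈ L', x = π • z)
    (hΨ' : ∀ x ∈ L', Ψ' x ∈ L') (hsmul : ∀ x, Ψ' (π • x) = π • Ψ' x)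
    {a b : ℕ} (hcomm : ∀ x, π ^ a • Ψ' (f x) = π ^ b • f (Ψ x)) (hf : f ≠ 0) : a = b := by
  have hcancel : ∀ (e : ℕ) (v : V'), ϖ ^ e • π ^ e • v = v := fun e v => by
    rw [smul_smul, ← mul_pow, hϖ, one_pow, one_smul]
  have hcancel' : ∀ (e : ℕ) (v : V'), π ^ e • ϖ ^ e • v = v := fun e v => by
    rw [smul_smul, ← mul_pow, mul_comm π, hϖ, one_pow, one_smul]
  have hpow : ∀ (e : ℕ) x, Ψ' (π ^ e • x) = π ^ e • Ψ' x := by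
    intro e
    induction e with
    | zero => simp
    | succ e ih => intro x; rw [pow_succ, mul_smul, ih, hsmul, ← mul_smul]
  have hpow' : ∀ (e : ℕ) x, Ψ' (ϖ ^ e • x) = ϖ ^ e • Ψ' x := fun e x => by
    conv_rhs => rw [← hcancel' e x, hpow, hcancel]
  have hL' : ∀ (e : ℕ), ∀ z ∈ L', π ^ e • z ∈ L' := fun e z hz =>
    L'.smul_mem ⟨π ^ e, pow_mem hπ e⟩ hz
  obtain ⟨N, hN⟩ := hbdd
  -- The largest e with π^N f(L) ⊆ π^e L'. If there were none, separatedness of L' would make f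
  -- vanish on L, hence everywhere.
  obtain ⟨e, he, hne⟩ : ∃ e : ℕ, (∀ x ∈ L, ∃ z ∈ L', π ^ N • f x = π ^ e • z) ∧
      ¬ ∀ x ∈ L, ∃ z ∈ L', π ^ N • f x = π ^ (e + 1) • z := by
    by_contra hcon
    push Not at hcon
    have hall : ∀ e : ℕ, ∀ x ∈ L, ∃ z ∈ L', π ^ N • f x = π ^ e • z := by
      intro e
      induction e with
      | zero => exact fun x hx => ⟨_, hN x hx, by simp⟩
      | succ e ih => exact hcon e ih
    apply hf
    apply hgen
    intro x hx
    have h0 := hsep _ fun e => hall e x hx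
    rw [← hcancel N (f x), h0, smul_zero]
  -- The normalised map: g L lies in L' but not in π L'.
  let g : V →ₗ[K] V' := (ϖ ^ e * π ^ N) • f
  have hg : ∀ x, g x = ϖ ^ e • π ^ N • f x := fun x => by simp [g, mul_smul]
  have hgL : ∀ x ∈ L, g x ∈ L' := fun x hx => by
    obtain ⟨z, hz, hxz⟩ := he x hx
    rwa [hg, hxz, hcancel]
  have hgne : ∃ x ∈ L, ¬ ∃ z ∈ L', g x = π • z := by
    by_contra hcon
    push Not at hcon
    apply hne
    intro x hx
    obtain ⟨z, hz, hxz⟩ := hcon x hx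
    refine ⟨z, hz, ?_⟩
    rw [pow_succ, mul_smul, ← hxz, hg, hcancel']
  have hgcomm : ∀ x, π ^ a • Ψ' (g x) = π ^ b • g (Ψ x) := fun x => by
    rw [hg, hg, hpow', hpow, smul_comm (π ^ a), smul_comm (π ^ a), hcomm,
      smul_comm (π ^ b), smul_comm (π ^ b)]
  have hdiv : ∀ (c d : ℕ) (y z : V'), c < d → π ^ c • y = π ^ d • z →
      y = π • π ^ (d - c - 1) • z := by
    intro c d y z hcd hyz
    rw [← hcancel c y, hyz, smul_smul, smul_smul, ← pow_succ']
    rw [show d - c - 1 + 1 = d - c by omega]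
    conv_lhs => rw [show d = c + (d - c) by omega, pow_add, ← mul_assoc, ← mul_pow, hϖ]
    simp
  rcases lt_trichotomy a b with hab | hab | hab
  · exfalso
    obtain ⟨x, hx, hxne⟩ := hgne
    exact hxne (hinj _ (hgL x hx) ⟨_, hL' _ _ (hgL _ (hΨ x hx)), hdiv a b _ _ hab (hgcomm x)⟩)
  · exact hab
  · exfalso
    obtain ⟨x, hx, hxne⟩ := hgne
    apply hxne
    -- Here g ∘ Ψ is divisible by π, and g is linear, so divisibility extends from Ψ L to its span,
    -- which contains L.
    have key : ∀ y ∈ Submodule.span S (Ψ '' L), ∃ z ∈ L', g y = π • z := by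
      intro y hy
      induction hy using Submodule.span_induction with
      | mem y hy =>
        obtain ⟨w, hw, rfl⟩ := hy
        exact ⟨_, hL' _ _ (hΨ' _ (hgL _ hw)), hdiv b a _ _ hab (hgcomm w).symm⟩
      | zero => exact ⟨0, zero_mem _, by simp⟩
      | add y₁ y₂ _ _ h₁ h₂ =>
        obtain ⟨z₁, hz₁, e₁⟩ := h₁
        obtain ⟨z₂, hz₂, e₂⟩ := h₂
        exact ⟨_, add_mem hz₁ hz₂, by rw [map_add, e₁, e₂, smul_add]⟩
      | smul s y _ h =>
        obtain ⟨z, hz, ez⟩ := h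
        refine ⟨s • z, L'.smul_mem s hz, ?_⟩
        rw [Subring.smul_def, Subring.smul_def, map_smul, ez, smul_comm]
    exact key x (hspan hx)

/-- Because φ preserves S, Ψ carries S-combinations of vectors to S-combinations of their images, so
spanning survives iteration. -/
theorem span_image_iterate {L : Submodule S V} {Ψ : V →+ V} {φ : K →+* K}
    (hφ : ∀ s ∈ S, φ s ∈ S) (hsemi : ∀ (a : K) x, Ψ (a • x) = φ a • Ψ x)
    (hspan : L ≤ Submodule.span S (Ψ '' L)) (m : ℕ) :
    L ≤ Submodule.span S (Ψ^[m] '' L) := by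
  induction m with
  | zero => simp
  | succ m ih =>
    refine hspan.trans (Submodule.span_le.2 ?_)
    rintro _ ⟨x, hx, rfl⟩
    have hx' := ih hx
    clear hx
    rw [SetLike.mem_coe]
    induction hx' using Submodule.span_induction with
    | mem y hy =>
      obtain ⟨w, hw, rfl⟩ := hy
      exact Submodule.subset_span ⟨w, hw, Function.iterate_succ_apply' _ _ _⟩
    | zero => simp
    | add y₁ y₂ _ _ h₁ h₂ => rw [map_add]; exact add_mem h₁ h₂
    | smul s y _ h =>
      rw [Subring.smul_def, hsemi]
      exact Submodule.smul_mem _ (⟨φ s, hφ s s.2⟩ : S) h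

end Lattice

/-! ### Sections, germs and local frames of sheaves of modules -/

section Sheaves

variable {X : Scheme.{u}}

/-- The restriction of sections of a sheaf of modules. -/
abbrev resSec (F : X.Modules) {V U : X.Opens} (h : V ≤ U) : Γ(F, U) →+ Γ(F, V) :=
  (F.presheaf.map (homOfLE h).op).hom

/-- The restriction of functions. -/
abbrev resFun {V U : X.Opens} (h : V ≤ U) : Γ(X, U) →+* Γ(X, V) :=
  (X.presheaf.map (homOfLE h).op).hom

/-- The germ of a section of a sheaf of modules. -/
abbrev germSec (F : X.Modules) {U : X.Opens} {x : X} (hx : x ∈ U) :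
    Γ(F, U) →+ F.presheaf.stalk x :=
  (F.presheaf.germ U x hx).hom

/-- The germ of a function. -/
abbrev germFun {U : X.Opens} {x : X} (hx : x ∈ U) : Γ(X, U) →+* X.presheaf.stalk x :=
  (X.presheaf.germ U x hx).hom

/-- The map on sections given by a morphism of sheaves of modules. -/
abbrev appSec {F G : X.Modules} (f : F ⟶ G) (U : X.Opens) : Γ(F, U) →+ Γ(G, U) := (f.app U).hom

variable (F : X.Modules)

lemma germSec_smul {U : X.Opens} {x : X} (hx : x ∈ U) (a : Γ(X, U)) (s : Γ(F, U)) :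
    germSec F hx (a • s) = germFun hx a • germSec F hx s :=
  let G : PresheafOfModules.{u} (X.presheaf ⋙ forget₂ CommRingCat RingCat) := F.val
  PresheafOfModules.germ_smul G x U hx a s

lemma resSec_smul {V U : X.Opens} (h : V ≤ U) (a : Γ(X, U)) (s : Γ(F, U)) :
    resSec F h (a • s) = resFun h a • resSec F h s :=
  Scheme.Modules.map_smul F (homOfLE h) a s

lemma germSec_res {V U : X.Opens} (h : V ≤ U) {x : X} (hx : x ∈ V) (s : Γ(F, U)) :
    germSec F hx (resSec F h s) = germSec F (h hx) s :=
  F.presheaf.germ_res_apply (homOfLE h) x hx s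

lemma germFun_res {V U : X.Opens} (h : V ≤ U) {x : X} (hx : x ∈ V) (s : Γ(X, U)) :
    germFun hx (resFun h s) = germFun (h hx) s :=
  X.presheaf.germ_res_apply (homOfLE h) x hx s

lemma resSec_resSec {W V U : X.Opens} (h : W ≤ V) (h' : V ≤ U) (s : Γ(F, U)) :
    resSec F h (resSec F h' s) = resSec F (h.trans h') s := by
  have := congr($(F.presheaf.map_comp (homOfLE h').op (homOfLE h).op).hom s)
  exact this.symm

lemma exists_germSec_eq {U : X.Opens} {x : X} (hx : x ∈ U) (y : F.presheaf.stalk x) :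
    ∃ (V : X.Opens) (_ : V ≤ U) (hV : x ∈ V) (s : Γ(F, V)), germSec F hV s = y := by
  obtain ⟨V, hVU, hV, s, hs⟩ := F.presheaf.exists_le_germ_eq y hx
  exact ⟨V, hVU, hV, s, hs⟩

lemma exists_germFun_eq {U : X.Opens} {x : X} (hx : x ∈ U) (y : X.presheaf.stalk x) :
    ∃ (V : X.Opens) (_ : V ≤ U) (hV : x ∈ V) (s : Γ(X, V)), germFun hV s = y := by
  obtain ⟨V, hVU, hV, s, hs⟩ := X.presheaf.exists_le_germ_eq y hx
  exact ⟨V, hVU, hV, s, hs⟩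

lemma exists_resSec_eq_zero {U : X.Opens} {x : X} (hx : x ∈ U) (s : Γ(F, U))
    (h : germSec F hx s = 0) : ∃ (V : X.Opens) (hV : V ≤ U), x ∈ V ∧ resSec F hV s = 0 := by
  obtain ⟨W, hW, i, j, e⟩ := F.presheaf.germ_eq x hx hx s 0 (h.trans (map_zero _).symm)
  refine ⟨W, leOfHom i, hW, ?_⟩
  exact e.trans (map_zero (F.presheaf.map j.op).hom)

/-- A family of germs of functions at a point is defined on a common neighbourhood. -/
lemma exists_germFun_family {U : X.Opens} {x : X} (hx : x ∈ U) {r : ℕ}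
    (a : Fin r → X.presheaf.stalk x) :
    ∃ (V : X.Opens) (_ : V ≤ U) (hV : x ∈ V) (c : Fin r → Γ(X, V)), ∀ j, germFun hV (c j) = a j := by
  choose V hVU hV s hs using fun j => exists_germFun_eq hx (a j)
  let W : X.Opens := U ⊓ Finset.univ.inf V
  have hW : ∀ j, W ≤ V j := fun j => inf_le_right.trans (Finset.inf_le (Finset.mem_univ j))
  have hxW : x ∈ W := by
    refine ⟨hx, ?_⟩
    have : ∀ t : Finset (Fin r), x ∈ t.inf V := by
      intro t
      induction t using Finset.induction_on with
      | empty => trivial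
      | insert j t _ ih => rw [Finset.inf_insert]; exact ⟨hV j, ih⟩
    exact this _
  exact ⟨W, inf_le_left, hxW, fun j => resFun (hW j) (s j), fun j => by
    rw [germFun_res, hs]⟩

variable {F}

/-- The sections `b` form a basis of the sheaf `F` over `U`. -/
def IsFrame {U : X.Opens} {r : ℕ} (b : Fin r → Γ(F, U)) : Prop :=
  ∀ (V : X.Opens) (h : V ≤ U), Function.Bijective fun a : Fin r → Γ(X, V) =>
    ∑ j, a j • resSec F h (b j)

lemma IsLocallyFreeOfRank.exists_frame {r : ℕ} (hF : IsLocallyFreeOfRank F r) (x : X) :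
    ∃ U : X.Opens, x ∈ U ∧ ∃ b : Fin r → Γ(F, U), IsFrame b := hF x

lemma IsFrame.res {U V : X.Opens} {r : ℕ} {b : Fin r → Γ(F, U)} (hb : IsFrame b) (h : V ≤ U) :
    IsFrame fun j => resSec F h (b j) := by
  intro W hW
  simp only [resSec_resSec]
  exact hb W (hW.trans h)

lemma IsFrame.exists_eq_sum {U : X.Opens} {r : ℕ} {b : Fin r → Γ(F, U)} (hb : IsFrame b)
    (s : Γ(F, U)) : ∃ a : Fin r → Γ(X, U), s = ∑ j, a j • b j := by
  obtain ⟨a, ha⟩ := (hb U le_rfl).2 s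
  refine ⟨a, ha.symm.trans ?_⟩
  refine Finset.sum_congr rfl fun j _ => ?_
  congr 1
  exact congr($(F.presheaf.map_id _).hom (b j))

/-- Finitely many germs, and any relation between them, live on one common neighbourhood, where the
frame property applies. -/
lemma IsFrame.germ_bijective {U : X.Opens} {r : ℕ} {b : Fin r → Γ(F, U)} (hb : IsFrame b)
    {x : X} (hx : x ∈ U) :
    Function.Bijective fun a : Fin r → X.presheaf.stalk x => ∑ j, a j • germSec F hx (b j) := by
  constructor
  · suffices h : ∀ a : Fin r → X.presheaf.stalk x, ∑ j, a j • germSec F hx (b j) = 0 → a = 0 by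
      intro a a' haa
      refine sub_eq_zero.1 (h _ ?_)
      simp only [Pi.sub_apply, sub_smul, Finset.sum_sub_distrib]
      exact sub_eq_zero.2 haa
    intro a ha
    obtain ⟨V, hVU, hV, c, hc⟩ := exists_germFun_family hx a
    have h0 : germSec F hV (∑ j, c j • resSec F hVU (b j)) = 0 := by
      rw [map_sum, ← ha]
      exact Finset.sum_congr rfl fun j _ => by rw [germSec_smul, germSec_res, hc]
    obtain ⟨W, hWV, hW, h1⟩ := exists_resSec_eq_zero F hV _ h0
    have h2 : (fun j => resFun hWV (c j)) = 0 := by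
      apply (hb W (hWV.trans hVU)).1
      simp only [Pi.zero_apply, zero_smul, Finset.sum_const_zero]
      rw [← h1, map_sum]
      exact Finset.sum_congr rfl fun j _ => by rw [resSec_smul, resSec_resSec]
    funext j
    rw [← hc j, ← germFun_res hWV hW, congrFun h2 j]
    simp
  · intro y
    obtain ⟨V, hVU, hV, s, rfl⟩ := exists_germSec_eq F hx y
    obtain ⟨a, rfl⟩ := (hb.res hVU).exists_eq_sum s
    refine ⟨fun j => germFun hV (a j), ?_⟩
    simp only [map_sum]
    exact Finset.sum_congr rfl fun j _ => by rw [germSec_smul, germSec_res]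

/-- The basis of the stalk given by a basis of the sheaf near the point. -/
def IsFrame.stalkBasis {U : X.Opens} {r : ℕ} {b : Fin r → Γ(F, U)} (hb : IsFrame b)
    {x : X} (hx : x ∈ U) : Module.Basis (Fin r) (X.presheaf.stalk x) (F.presheaf.stalk x) :=
  .ofEquivFun (LinearEquiv.ofBijective (Fintype.linearCombination (X.presheaf.stalk x)
    fun j => germSec F hx (b j)) (hb.germ_bijective hx)).symm

lemma IsFrame.stalkBasis_apply {U : X.Opens} {r : ℕ} {b : Fin r → Γ(F, U)} (hb : IsFrame b)
    {x : X} (hx : x ∈ U) (j : Fin r) : hb.stalkBasis hx j = germSec F hx (b j) := by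
  rw [IsFrame.stalkBasis, Module.Basis.coe_ofEquivFun, LinearEquiv.symm_symm]
  change Fintype.linearCombination (X.presheaf.stalk x) (fun j => germSec F hx (b j))
    (Pi.single j 1) = _
  rw [Fintype.linearCombination_apply_single, one_smul]

/-- A section of `F` whose germs all vanish is zero. -/
lemma eq_zero_of_germSec {U : X.Opens} (s : Γ(F, U))
    (h : ∀ (x : X) (hx : x ∈ U), germSec F hx s = 0) : s = 0 := by
  refine TopCat.Presheaf.section_ext ⟨F.presheaf, F.isSheaf⟩ U s 0 fun x hx => ?_
  exact (h x hx).trans (map_zero (F.presheaf.germ U x hx).hom).symm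

/-- On an integral scheme, a section of a locally free sheaf with trivial germ at the generic point
is zero. -/
lemma eq_zero_of_germSec_genericPoint [IsIntegral X] {r : ℕ} (hF : IsLocallyFreeOfRank F r)
    {U : X.Opens} (s : Γ(F, U)) (h : ∀ hx : genericPoint X ∈ U, germSec F hx s = 0) : s = 0 := by
  refine eq_zero_of_germSec s fun x hx => ?_
  obtain ⟨W, hxW, b, hb⟩ := hF.exists_frame x
  have hgen : ∀ V : X.Opens, x ∈ V → genericPoint X ∈ V := fun V hV =>
    ((genericPoint_spec X).mem_open_set_iff V.isOpen).mpr ⟨x, trivial, hV⟩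
  have hη := hgen (U ⊓ W) ⟨hx, hxW⟩
  obtain ⟨a, ha⟩ := (hb.res (inf_le_right : U ⊓ W ≤ W)).exists_eq_sum
    (resSec F (inf_le_left : U ⊓ W ≤ U) s)
  have h0 : (fun j => germFun hη (a j)) = 0 := by
    apply ((hb.res (inf_le_right : U ⊓ W ≤ W)).germ_bijective hη).1
    simp only [Pi.zero_apply, zero_smul, Finset.sum_const_zero]
    rw [← h (hgen U hx), ← germSec_res F inf_le_left hη, ha, map_sum]
    exact Finset.sum_congr rfl fun j _ => by rw [germSec_smul]
  have h1 : ∀ j, a j = 0 := fun j => by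
    apply germ_injective_of_isIntegral X (genericPoint X) hη
    exact (congrFun h0 j).trans (map_zero (germFun hη)).symm
  rw [← germSec_res F inf_le_left ⟨hx, hxW⟩, ha]
  simp [h1]

lemma appSec_res {F G : X.Modules} (f : F ⟶ G) {V U : X.Opens} (h : V ≤ U) (s : Γ(F, U)) :
    appSec f V (resSec F h s) = resSec G h (appSec f U s) := by
  exact congr($(f.mapPresheaf.naturality (homOfLE h).op).hom s)

lemma appSec_smul {F G : X.Modules} (f : F ⟶ G) {U : X.Opens} (a : Γ(X, U)) (s : Γ(F, U)) :
    appSec f U (a • s) = a • appSec f U s :=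
  Scheme.Modules.Hom.app_smul f a s

/-- A morphism of locally free sheaves on an integral scheme which vanishes on the sections over a
nonempty open set over which the source is free, is zero. -/
lemma hom_eq_zero_of_isFrame [IsIntegral X] {F G : X.Modules} {r r' : ℕ} (f : F ⟶ G)
    (hG : IsLocallyFreeOfRank G r') {U : X.Opens} {x : X} (hx : x ∈ U) {b : Fin r → Γ(F, U)}
    (hb : IsFrame b) (h : ∀ j, appSec f U (b j) = 0) : f = 0 := by
  refine Scheme.Modules.hom_ext _ _ fun W => ?_
  ext s
  refine eq_zero_of_germSec_genericPoint hG _ fun hη => ?_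
  have hη' : genericPoint X ∈ W ⊓ U :=
    ⟨hη, ((genericPoint_spec X).mem_open_set_iff U.isOpen).mpr ⟨x, trivial, hx⟩⟩
  obtain ⟨a, ha⟩ := (hb.res (inf_le_right : W ⊓ U ≤ U)).exists_eq_sum
    (resSec F (inf_le_left : W ⊓ U ≤ W) s)
  change germSec G hη (appSec f W s) = 0
  rw [← germSec_res G inf_le_left hη', ← appSec_res, ha, map_sum]
  simp [appSec_res, h]

lemma stalkSpecializes_germSec (F : X.Modules) {x y : X} (h : y ⤳ x) {U : X.Opens} (hx : x ∈ U)
    (s : Γ(F, U)) : (F.presheaf.stalkSpecializes h).hom (germSec F hx s) =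
      germSec F (h.mem_open U.isOpen hx) s :=
  congr($(F.presheaf.germ_stalkSpecializes hx h).hom s)

lemma stalkSpecializes_germFun {x y : X} (h : y ⤳ x) {U : X.Opens} (hx : x ∈ U)
    (s : Γ(X, U)) : (X.presheaf.stalkSpecializes h).hom (germFun hx s) =
      germFun (h.mem_open U.isOpen hx) s :=
  congr($(X.presheaf.germ_stalkSpecializes hx h).hom s)

lemma stalkSpecializes_smul (F : X.Modules) {x y : X} (h : y ⤳ x) (a : X.presheaf.stalk x)
    (s : F.presheaf.stalk x) : (F.presheaf.stalkSpecializes h).hom (a • s) =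
      (X.presheaf.stalkSpecializes h).hom a • (F.presheaf.stalkSpecializes h).hom s := by
  obtain ⟨U, -, hU, a, rfl⟩ := exists_germFun_eq (U := ⊤) (x := x) trivial a
  obtain ⟨V, hVU, hV, s, rfl⟩ := exists_germSec_eq F hU s
  rw [← germFun_res hVU hV, ← germSec_smul, stalkSpecializes_germSec, stalkSpecializes_germSec,
    stalkSpecializes_germFun, germSec_smul]

end Sheaves

/-! ### Local rings of smooth curves at rational points -/

section SmoothOverField

/-- A smooth scheme over a field is reduced. -/
theorem isReduced_of_smooth_spec {K : Type u} [Field K] {Y : Scheme.{u}} (f : Y ⟶ Spec (.of K))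
    [Smooth f] : IsReduced Y := by
  refine (IsReduced.iff_of_openCover Y Y.affineCover).2 fun i => ?_
  have hs : Smooth (Y.affineCover.f i ≫ f) := inferInstance
  have hs' : (Y.affineCover.f i ≫ f).appTop.hom.Smooth :=
    (HasRingHomProperty.iff_of_isAffine (P := @Smooth)).1 hs
  let e : K ≃+* Γ(Spec (.of K), ⊤) := (Scheme.ΓSpecIso (.of K)).symm.commRingCatIsoToRingEquiv
  have h2 : ((Y.affineCover.f i ≫ f).appTop.hom.comp e.toRingHom).Smooth :=
    RingHom.Smooth.respectsIso.2 _ e hs'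
  let := ((Y.affineCover.f i ≫ f).appTop.hom.comp e.toRingHom).toAlgebra
  have : Algebra.Smooth K Γ(Y.affineCover.X i, ⊤) := h2
  have : _root_.IsReduced Γ(Y.affineCover.X i, ⊤) := isReduced_of_smooth K _
  exact isReduced_of_isAffine_isReduced _

variable {K : Type u} [Field K] {Y : Scheme.{u}}

lemma eq_closedPoint (p : Spec (.of K)) : p = IsLocalRing.closedPoint K :=
  Subsingleton.elim (α := PrimeSpectrum K) _ _

/-- A function on a neighbourhood of a rational point is in the maximal ideal of the local ring if
and only if its pullback along the point vanishes. -/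
lemma germFun_mem_maximalIdeal_iff (s : Spec (.of K) ⟶ Y) {V : Y.Opens}
    (hV : s (IsLocalRing.closedPoint K) ∈ V) (a : Γ(Y, V)) :
    germFun hV a ∈ IsLocalRing.maximalIdeal (Y.presheaf.stalk (s (IsLocalRing.closedPoint K))) ↔
      (s.app V).hom a = 0 := by
  rw [IsLocalRing.mem_maximalIdeal, mem_nonunits_iff]
  have h1 : IsUnit (germFun hV a) ↔ s (IsLocalRing.closedPoint K) ∈ Y.basicOpen a :=
    (Y.mem_basicOpen a _ hV).symm
  rw [h1]
  have h2 : s ⁻¹ᵁ Y.basicOpen a = (Spec (.of K)).basicOpen ((s.app V).hom a) :=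
    Scheme.preimage_basicOpen s a
  have h3 : (Spec (.of K)).basicOpen ((s.app V).hom a) = ⊥ ↔ (s.app V).hom a = 0 :=
    basicOpen_eq_bot_iff _
  rw [← h3, ← h2]
  constructor
  · intro h
    refine le_bot_iff.1 fun p hp => h ?_
    rw [eq_closedPoint p] at hp
    exact hp
  · intro h hmem
    have : IsLocalRing.closedPoint K ∈ s ⁻¹ᵁ Y.basicOpen a := hmem
    rw [h] at this
    exact this

/-- The maximal ideal of the local ring at a rational point is generated by the functions on an
affine neighbourhood whose pullback along the point vanishes. -/
lemma maximalIdeal_eq_map_ker (s : Spec (.of K) ⟶ Y) {V : Y.Opens} (hVa : IsAffineOpen V)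
    (hV : s (IsLocalRing.closedPoint K) ∈ V) :
    IsLocalRing.maximalIdeal (Y.presheaf.stalk (s (IsLocalRing.closedPoint K))) =
      (RingHom.ker (s.app V).hom).map (germFun hV) := by
  let := Y.presheaf.algebra_section_stalk (⟨_, hV⟩ : V)
  have hloc := hVa.isLocalization_stalk ⟨_, hV⟩
  let p := (hVa.primeIdealOf ⟨_, hV⟩).asIdeal
  have h1 : p.map (germFun hV) = IsLocalRing.maximalIdeal _ :=
    IsLocalization.AtPrime.map_eq_maximalIdeal p
      (Y.presheaf.stalk (s (IsLocalRing.closedPoint K)))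
  have h2 : (IsLocalRing.maximalIdeal
      (Y.presheaf.stalk (s (IsLocalRing.closedPoint K)))).comap (germFun hV) = p :=
    IsLocalization.AtPrime.under_maximalIdeal
      (Y.presheaf.stalk (s (IsLocalRing.closedPoint K))) p
  have h3 : RingHom.ker (s.app V).hom = p := by
    rw [← h2]
    ext a
    exact (germFun_mem_maximalIdeal_iff s hV a).symm
  rw [h3, h1]

lemma appLE_eq_id {Z : Scheme.{u}} {g : Z ⟶ Z} (hg : g = 𝟙 Z) (U : Z.Opens) (h : U ≤ g ⁻¹ᵁ U) :
    g.appLE U U h = 𝟙 _ := by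
  subst hg
  simp only [Scheme.Hom.appLE, Scheme.Hom.id_app]
  exact (Category.id_comp _).trans (Z.presheaf.map_id _)

/-- The local ring of a smooth integral curve over a field at a rational point is a discrete
valuation ring. -/
theorem isDiscreteValuationRing_stalk (f : Y ⟶ Spec (.of K)) [SmoothOfRelativeDimension 1 f]
    [IsIntegral Y] [IsLocallyNoetherian Y] (s : Spec (.of K) ⟶ Y) (hs : s ≫ f = 𝟙 _) :
    IsDiscreteValuationRing (Y.presheaf.stalk (s (IsLocalRing.closedPoint K))) := by
  set x := s (IsLocalRing.closedPoint K) with hxdef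
  obtain ⟨U, hU, V, hVa, hxV, e, hstd⟩ :=
    SmoothOfRelativeDimension.exists_isStandardSmoothOfRelativeDimension (n := 1) (f := f) x
  have hUV : U = s ⁻¹ᵁ V := by
    have hU' : IsLocalRing.closedPoint K ∈ U := by
      have := e hxV
      rwa [Scheme.Hom.mem_preimage, eq_closedPoint (f x)] at this
    ext p
    rw [eq_closedPoint p]
    exact ⟨fun _ => hxV, fun _ => hU'⟩
  subst hUV
  have hne : Nonempty (s ⁻¹ᵁ V) := ⟨⟨_, hxV⟩⟩
  have hcomp : (s.app V).hom.comp (f.appLE (s ⁻¹ᵁ V) V e).hom = RingHom.id _ := by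
    have h1 : f.appLE (s ⁻¹ᵁ V) V e ≫ s.appLE V (s ⁻¹ᵁ V) le_rfl =
        (s ≫ f).appLE (s ⁻¹ᵁ V) (s ⁻¹ᵁ V) (by rw [hs]; exact le_rfl) :=
      Scheme.Hom.appLE_comp_appLE _ _ _ _ _ _ _
    rw [Scheme.Hom.appLE_eq_app] at h1
    have h2 : (s ≫ f).appLE (s ⁻¹ᵁ V) (s ⁻¹ᵁ V) (by rw [hs]; exact le_rfl) = 𝟙 _ := appLE_eq_id hs _ _
    have := h1.trans h2
    exact congr($(this).hom)
  obtain ⟨hbot, t, ht, hgen⟩ := exists_mem_ker_section_of_standardSmooth _ _ hcomp hstd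
  have hm := maximalIdeal_eq_map_ker s hVa hxV
  -- The hypothesis of Nakayama's lemma: t generates the maximal ideal modulo its square.
  have hle : IsLocalRing.maximalIdeal (Y.presheaf.stalk x) ≤ Ideal.span {germFun hxV t} ⊔
      IsLocalRing.maximalIdeal (Y.presheaf.stalk x) •
        IsLocalRing.maximalIdeal (Y.presheaf.stalk x) := by
    conv_lhs => rw [hm]
    rw [Ideal.map_le_iff_le_comap]
    intro a ha
    obtain ⟨b, hb⟩ := hgen a ha
    have h1 : germFun hxV a = germFun hxV (b * t) + germFun hxV (a - b * t) := by
      rw [← map_add]; congr 1; ring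
    rw [Ideal.mem_comap, h1]
    refine Submodule.add_mem_sup ?_ ?_
    · rw [map_mul]
      exact Ideal.mul_mem_left _ _ (Ideal.mem_span_singleton_self _)
    · rw [smul_eq_mul, ← pow_two, hm, ← Ideal.map_pow]
      exact Ideal.mem_map_of_mem _ hb
  have hspan : IsLocalRing.maximalIdeal (Y.presheaf.stalk x) = Ideal.span {germFun hxV t} := by
    apply le_antisymm
    · exact Submodule.le_of_le_smul_of_le_jacobson_bot (IsNoetherian.noetherian _)
        (IsLocalRing.jacobson_eq_maximalIdeal _ bot_ne_top).ge hle
    · rw [Ideal.span_singleton_le_iff_mem, hm]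
      exact Ideal.mem_map_of_mem _ ht
  have hne : IsLocalRing.maximalIdeal (Y.presheaf.stalk x) ≠ ⊥ := by
    intro h0
    apply hbot
    rw [eq_bot_iff]
    intro a ha
    have h1 : germFun hxV a ∈ IsLocalRing.maximalIdeal (Y.presheaf.stalk x) := by
      rw [hm]; exact Ideal.mem_map_of_mem _ ha
    rw [h0, Ideal.mem_bot] at h1
    exact germ_injective_of_isIntegral Y x hxV (h1.trans (map_zero (germFun hxV)).symm)
  have hpid : IsPrincipalIdealRing (Y.presheaf.stalk x) :=
    ((tfae_of_isNoetherianRing_of_isLocalRing_of_isDomain (Y.presheaf.stalk x)).out 0 4).2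
      (show (IsLocalRing.maximalIdeal (Y.presheaf.stalk x)).IsPrincipal from ⟨⟨_, hspan⟩⟩)
  exact ⟨hne⟩

/-- If the maximal ideal of a discrete valuation ring is generated by a set, then it is generated
by one of the elements of the set. -/
lemma exists_mem_maximalIdeal_eq_span {O : Type*} [CommRing O] [IsDomain O]
    [IsDiscreteValuationRing O] {T : Set O} (hT : IsLocalRing.maximalIdeal O = Ideal.span T) :
    ∃ t ∈ T, IsLocalRing.maximalIdeal O = Ideal.span {t} := by
  obtain ⟨ϖ, hϖ⟩ := IsDiscreteValuationRing.exists_irreducible O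
  have hm := hϖ.maximalIdeal_eq
  by_contra hcon
  push Not at hcon
  -- If no element of T is a uniformizer, each has valuation at least 2, and so has everything they
  -- generate, including ϖ.
  have h1 : IsLocalRing.maximalIdeal O ≤ Ideal.span {ϖ ^ 2} := by
    rw [hT, Ideal.span_le]
    intro t ht
    have htm : t ∈ IsLocalRing.maximalIdeal O := by rw [hT]; exact Ideal.subset_span ht
    rw [hm, Ideal.mem_span_singleton] at htm
    obtain ⟨c, rfl⟩ := htm
    rw [SetLike.mem_coe, Ideal.mem_span_singleton, pow_two]
    by_cases hc : IsUnit c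
    · exfalso
      refine hcon _ ht ?_
      rw [hm, Ideal.span_singleton_mul_right_unit hc]
    · have : c ∈ IsLocalRing.maximalIdeal O := hc
      rw [hm, Ideal.mem_span_singleton] at this
      exact mul_dvd_mul_left _ this
  have h2 : ϖ ∈ Ideal.span {ϖ ^ 2} := h1 (by rw [hm]; exact Ideal.mem_span_singleton_self _)
  rw [Ideal.mem_span_singleton, pow_two] at h2
  obtain ⟨c, hc⟩ := h2
  apply hϖ.not_isUnit
  refine IsUnit.of_mul_eq_one c ?_
  have := mul_left_cancel₀ hϖ.ne_zero (show ϖ * (ϖ * c) = ϖ * 1 by rw [mul_one, ← mul_assoc]; exact hc.symm)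
  exact this

end SmoothOverField

/-! ### Functions on base changes and constants at a rational point -/

section Pushout

/-- A pushout of commutative rings is generated by the images of the two rings. -/
lemma closure_eq_top_of_isPushout {R A B P : CommRingCat.{u}} {f : R ⟶ A} {g : R ⟶ B} {i : A ⟶ P}
    {j : B ⟶ P} (h : IsPushout f g i j) :
    Subring.closure (Set.range i.hom ∪ Set.range j.hom) = ⊤ := by
  set S := Subring.closure (Set.range i.hom ∪ Set.range j.hom) with hS
  let i' : A ⟶ .of S := CommRingCat.ofHom (i.hom.codRestrict S fun a =>
    Subring.subset_closure (.inl ⟨a, rfl⟩))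
  let j' : B ⟶ .of S := CommRingCat.ofHom (j.hom.codRestrict S fun a =>
    Subring.subset_closure (.inr ⟨a, rfl⟩))
  have hw : f ≫ i' = g ≫ j' := by
    ext r
    have h1 : i.hom (f.hom r) = j.hom (g.hom r) := congrArg (fun k => k.hom r) h.w
    exact h1
  -- The identity of P factors through the subring S by the universal property, so S is all of P.
  have hid : h.desc i' j' hw ≫ CommRingCat.ofHom S.subtype = 𝟙 P := by
    apply h.hom_ext
    · rw [← Category.assoc, h.inl_desc, Category.comp_id]; rfl
    · rw [← Category.assoc, h.inr_desc, Category.comp_id]; rfl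
  rw [eq_top_iff]
  intro p _
  have := congr($(hid).hom p)
  rw [show p = ((h.desc i' j' hw).hom p : S) from this.symm]
  exact Subtype.prop _

end Pushout

section Generalities

lemma topIso_hom_comp_app {Y Z : Scheme.{u}} (f : Y ⟶ Z) (V : Z.Opens) :
    V.topIso.hom ≫ f.app V = (f ∣_ V).appTop ≫ (f ⁻¹ᵁ V).topIso.hom := by
  rw [Scheme.Hom.appTop, morphismRestrict_app', Scheme.Opens.topIso_hom,
    Scheme.Opens.topIso_hom, ← Scheme.Hom.appLE_eq_app]
  exact (Scheme.Hom.map_appLE ..).trans (Scheme.Hom.appLE_map ..).symm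

lemma map_homOfLE_eq_ι_appTop_comp {Y : Scheme.{u}} (V : Y.Opens) :
    Y.presheaf.map (homOfLE le_top : V ⟶ ⊤).op = V.ι.appTop ≫ V.topIso.hom := by
  rw [Scheme.Opens.ι_appTop, Scheme.Opens.topIso_hom]
  exact Y.presheaf.map_comp _ _

variable {K : Type u} [Field K] {Y : Scheme.{u}}

/-- The structure map `K → Γ(V, 𝒪_Y)` of a scheme over a field. -/
def constants (f : Y ⟶ Spec (.of K)) (V : Y.Opens) : K →+* Γ(Y, V) :=
  ((Scheme.ΓSpecIso (.of K)).inv ≫ f.appTop ≫ Y.presheaf.map (homOfLE le_top).op).hom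

/-- Pulling back a constant along a section gives back the constant. -/
lemma app_constants {f : Y ⟶ Spec (.of K)} {s : Spec (.of K) ⟶ Y} (hs : s ≫ f = 𝟙 _)
    (V : Y.Opens) (c : K) : (s.app V).hom (constants f V c) = constants (𝟙 _) (s ⁻¹ᵁ V) c := by
  have h1 : Y.presheaf.map (homOfLE le_top : V ⟶ ⊤).op ≫ s.app V =
      s.appTop ≫ (Spec (.of K)).presheaf.map (homOfLE le_top).op := by
    rw [Scheme.Hom.naturality]; rfl
  have h2 : f.appTop ≫ s.appTop = (𝟙 (Spec (.of K)) : _ ⟶ _).appTop := by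
    rw [← Scheme.Hom.comp_appTop, hs]
  have h3 : ((Scheme.ΓSpecIso (.of K)).inv ≫ f.appTop ≫
      Y.presheaf.map (homOfLE le_top : V ⟶ ⊤).op) ≫ s.app V =
      (Scheme.ΓSpecIso (.of K)).inv ≫ (𝟙 (Spec (.of K)) : _ ⟶ _).appTop ≫
        (Spec (.of K)).presheaf.map (homOfLE le_top).op := by
    rw [Category.assoc, Category.assoc, h1, reassoc_of% h2]
  exact congrArg (fun g => g.hom c) h3

lemma constants_id_surjective {U : (Spec (.of K)).Opens} (hU : IsLocalRing.closedPoint K ∈ U) :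
    Function.Surjective (constants (𝟙 (Spec (.of K))) U) := by
  obtain rfl : U = ⊤ := by
    ext p
    rw [eq_closedPoint p]
    exact ⟨fun _ => trivial, fun _ => hU⟩
  intro r
  refine ⟨(Scheme.ΓSpecIso (.of K)).hom.hom r, ?_⟩
  have h : (Scheme.ΓSpecIso (.of K)).hom ≫ (Scheme.ΓSpecIso (.of K)).inv ≫
      (𝟙 (Spec (.of K)) : _ ⟶ _).appTop ≫
      (Spec (.of K)).presheaf.map (homOfLE le_top : (⊤ : (Spec (.of K)).Opens) ⟶ ⊤).op = 𝟙 _ := by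
    rw [Iso.hom_inv_id_assoc]
    exact (Category.id_comp _).trans ((Spec (.of K)).presheaf.map_id _)
  exact congrArg (fun g => g.hom r) h

/-- A function on a neighbourhood of a rational point differs from a constant by a function which
vanishes at the point. -/
lemma exists_sub_constants_mem_ker {f : Y ⟶ Spec (.of K)} {s : Spec (.of K) ⟶ Y}
    (hs : s ≫ f = 𝟙 _) {V : Y.Opens} (hV : s (IsLocalRing.closedPoint K) ∈ V) (b : Γ(Y, V)) :
    ∃ c : K, b - constants f V c ∈ RingHom.ker (s.app V).hom := by
  obtain ⟨c, hc⟩ := constants_id_surjective (U := s ⁻¹ᵁ V) hV ((s.app V).hom b)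
  exact ⟨c, by rw [RingHom.mem_ker, map_sub, app_constants hs, hc, sub_self]⟩

lemma eq_zero_of_app_constants_eq_zero {f : Y ⟶ Spec (.of K)} {s : Spec (.of K) ⟶ Y}
    (hs : s ≫ f = 𝟙 _) {V : Y.Opens} (hV : s (IsLocalRing.closedPoint K) ∈ V) {c : K}
    (h : (s.app V).hom (constants f V c) = 0) : c = 0 := by
  rw [app_constants hs] at h
  have : Nonempty (s ⁻¹ᵁ V) := ⟨⟨_, hV⟩⟩
  exact (constants (𝟙 (Spec (.of K))) (s ⁻¹ᵁ V)).injective (h.trans (map_zero _).symm)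

lemma app_eq_zero_of_comp_eq {Y' Z Z' : Scheme.{u}} {f : Y' ⟶ Z} {g : Z ⟶ Y} {f' : Y' ⟶ Z'}
    {g' : Z' ⟶ Y} (h : f ≫ g = f' ≫ g') {V : Y.Opens} {b : Γ(Y, V)} (hb : (g'.app V).hom b = 0) :
    (f.app (g ⁻¹ᵁ V)).hom ((g.app V).hom b) = 0 := by
  have h1 : ((f' ≫ g').app V).hom b = 0 := by
    rw [Scheme.Hom.comp_app]
    exact (congrArg (f'.app _).hom hb).trans (map_zero _)
  have h2 : ∀ u : Y' ⟶ Y, f' ≫ g' = u → (u.app V).hom b = 0 := by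
    rintro u rfl; exact h1
  exact h2 _ h.symm

end Generalities

/-! ### Integrality of C_L and a uniformizer at ∞ coming from C -/

namespace PointedCurve

variable {k : Type u} [Field k] (X : PointedCurve k) (L : Type u) [Field L] [Algebra k L]

instance smoothOfRelativeDimension_pr₂ : SmoothOfRelativeDimension 1 (X.pr₂ L) :=
  (smoothOfRelativeDimension_isStableUnderBaseChange 1).of_isPullback
    (IsPullback.of_hasPullback X.π (Spec.map (CommRingCat.ofHom (algebraMap k L)))) X.smooth

instance smooth_pr₂ : Smooth (X.pr₂ L) := SmoothOfRelativeDimension.smooth 1 _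

instance isReduced_CL : IsReduced (X.CL L) := isReduced_of_smooth_spec (X.pr₂ L)

instance isIntegral_CL : IsIntegral (X.CL L) := isIntegral_of_irreducibleSpace_of_isReduced _

instance isLocallyNoetherian_CL : IsLocallyNoetherian (X.CL L) :=
  LocallyOfFiniteType.isLocallyNoetherian (X.pr₂ L)

lemma ptL_pr₂ : X.ptL L ≫ X.pr₂ L = 𝟙 _ := Limits.pullback.lift_snd _ _ _

lemma ptL_pr₁ : X.ptL L ≫ X.pr₁ L =
    Spec.map (CommRingCat.ofHom (algebraMap k L)) ≫ X.pt := Limits.pullback.lift_fst _ _ _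

instance isDiscreteValuationRing_stalk_inftyL :
    IsDiscreteValuationRing ((X.CL L).presheaf.stalk (X.inftyL L)) :=
  isDiscreteValuationRing_stalk (X.pr₂ L) (X.ptL L) (X.ptL_pr₂ L)

/-- The functions on the preimage of an affine open set `V ⊆ C` are generated by the functions on
`V` and the constants. -/
lemma closure_sections_eq_top {V : X.C.Opens} (hV : IsAffineOpen V) :
    Subring.closure (Set.range ((X.pr₁ L).app V).hom ∪
      Set.range (X.scalars L (X.pr₁ L ⁻¹ᵁ V))) = ⊤ := by
  have : IsAffine V := hV
  have h1 := (isPullback_morphismRestrict (X.pr₁ L) V).paste_vert (IsPullback.of_hasPullback X.π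
    (Spec.map (CommRingCat.ofHom (algebraMap k L))))
  have h2 := closure_eq_top_of_isPushout (isPushout_appTop_of_isPullback h1)
  let W := X.pr₁ L ⁻¹ᵁ V
  have hψ : Function.Surjective W.topIso.hom.hom :=
    W.topIso.commRingCatIsoToRingEquiv.surjective
  have h3 := congrArg (Subring.map W.topIso.hom.hom) h2
  rw [RingHom.map_closure, ← RingHom.range_eq_map, RingHom.range_eq_top.2 hψ] at h3
  rw [eq_top_iff, ← h3]
  refine Subring.closure_mono ?_
  rintro _ ⟨_, ⟨b, rfl⟩ | ⟨c, rfl⟩, rfl⟩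
  · left
    refine ⟨V.topIso.hom.hom b, ?_⟩
    have h4 := topIso_hom_comp_app (X.pr₁ L) V
    exact congrArg (fun g => g.hom b) h4
  · right
    refine ⟨(Scheme.ΓSpecIso (.of L)).hom.hom c, ?_⟩
    have h4 : (Scheme.ΓSpecIso (.of L)).hom ≫ CommRingCat.ofHom (X.scalars L W) =
        (W.ι ≫ X.pr₂ L).appTop ≫ W.topIso.hom := by
      rw [scalars, CommRingCat.ofHom_hom, Iso.hom_inv_id_assoc, Scheme.Hom.comp_appTop,
        Category.assoc]
      exact congrArg ((X.pr₂ L).appTop ≫ ·) (map_homOfLE_eq_ι_appTop_comp W)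
    exact congrArg (fun g => g.hom c) h4

lemma inftyL_mem_preimage {V : X.C.Opens} (hV : X.pt (IsLocalRing.closedPoint k) ∈ V) :
    X.inftyL L ∈ X.pr₁ L ⁻¹ᵁ V := by
  have h : (X.ptL L ≫ X.pr₁ L) (IsLocalRing.closedPoint L) = X.pt (IsLocalRing.closedPoint k) := by
    rw [ptL_pr₁]
    exact congrArg X.pt (eq_closedPoint _)
  change (X.ptL L ≫ X.pr₁ L) (IsLocalRing.closedPoint L) ∈ V
  rwa [h]

lemma app_pr₁_constants (V : X.C.Opens) (c : k) :
    ((X.pr₁ L).app V).hom (constants X.π V c) =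
      X.scalars L (X.pr₁ L ⁻¹ᵁ V) (algebraMap k L c) := by
  have h1 : X.C.presheaf.map (homOfLE le_top : V ⟶ ⊤).op ≫ (X.pr₁ L).app V =
      (X.pr₁ L).appTop ≫ (X.CL L).presheaf.map (homOfLE le_top).op := by
    rw [Scheme.Hom.naturality]; rfl
  have h0 : X.π.appTop ≫ (X.pr₁ L).appTop =
      (Spec.map (CommRingCat.ofHom (algebraMap k L))).appTop ≫ (X.pr₂ L).appTop := by
    rw [← Scheme.Hom.comp_appTop, ← Scheme.Hom.comp_appTop, Limits.pullback.condition]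
  have h : ((Scheme.ΓSpecIso (.of k)).inv ≫ X.π.appTop ≫
      X.C.presheaf.map (homOfLE le_top : V ⟶ ⊤).op) ≫ (X.pr₁ L).app V =
      CommRingCat.ofHom (algebraMap k L) ≫ (Scheme.ΓSpecIso (.of L)).inv ≫
        (X.pr₂ L).appTop ≫ (X.CL L).presheaf.map (homOfLE le_top).op := by
    rw [Scheme.ΓSpecIso_inv_naturality_assoc, Category.assoc, Category.assoc, h1,
      reassoc_of% h0]
  exact congrArg (fun g => g.hom c) h

/-- The functions on the preimage of an affine neighbourhood `V` of `∞` which vanish at `∞` are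
generated by the functions on `V` which vanish at `∞`. -/
lemma ker_ptL_le_span {V : X.C.Opens} (hVa : IsAffineOpen V)
    (hV : X.pt (IsLocalRing.closedPoint k) ∈ V) :
    RingHom.ker ((X.ptL L).app (X.pr₁ L ⁻¹ᵁ V)).hom ≤
      Ideal.span (((X.pr₁ L).app V).hom '' RingHom.ker (X.pt.app V).hom) := by
  set J := Ideal.span (((X.pr₁ L).app V).hom '' RingHom.ker (X.pt.app V).hom) with hJ
  have hJle : J ≤ RingHom.ker ((X.ptL L).app (X.pr₁ L ⁻¹ᵁ V)).hom := by
    rw [hJ, Ideal.span_le]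
    rintro _ ⟨b, hb, rfl⟩
    exact app_eq_zero_of_comp_eq (X.ptL_pr₁ L) hb
  -- Every function is a constant modulo J: this holds for the ring generators and is stable under
  -- the ring operations. For g vanishing at ∞ the constant must then be 0.
  have hmem : ∀ g : Γ(X.CL L, X.pr₁ L ⁻¹ᵁ V), ∃ l : L, g - X.scalars L _ l ∈ J := by
    intro g
    have hg : g ∈ Subring.closure (Set.range ((X.pr₁ L).app V).hom ∪
      Set.range (X.scalars L (X.pr₁ L ⁻¹ᵁ V))) := by
      rw [X.closure_sections_eq_top L hVa]; trivial
    induction hg using Subring.closure_induction with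
    | mem g hg =>
      rcases hg with ⟨b, rfl⟩ | ⟨l, rfl⟩
      · obtain ⟨c, hc⟩ := exists_sub_constants_mem_ker X.pt_π hV b
        refine ⟨algebraMap k L c, ?_⟩
        rw [← app_pr₁_constants, ← map_sub]
        exact Ideal.subset_span ⟨_, hc, rfl⟩
      · exact ⟨l, by rw [sub_self]; exact J.zero_mem⟩
    | zero => exact ⟨0, by rw [map_zero, sub_self]; exact J.zero_mem⟩
    | one => exact ⟨1, by rw [map_one, sub_self]; exact J.zero_mem⟩
    | add g₁ g₂ _ _ h₁ h₂ =>
      obtain ⟨l₁, h₁⟩ := h₁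
      obtain ⟨l₂, h₂⟩ := h₂
      refine ⟨l₁ + l₂, ?_⟩
      rw [map_add, add_sub_add_comm]
      exact J.add_mem h₁ h₂
    | neg g _ h =>
      obtain ⟨l, h⟩ := h
      refine ⟨-l, ?_⟩
      rw [map_neg, ← neg_sub', neg_mem_iff]
      exact h
    | mul g₁ g₂ _ _ h₁ h₂ =>
      obtain ⟨l₁, h₁⟩ := h₁
      obtain ⟨l₂, h₂⟩ := h₂
      refine ⟨l₁ * l₂, ?_⟩
      have : g₁ * g₂ - X.scalars L _ (l₁ * l₂) = (g₁ - X.scalars L _ l₁) * g₂ +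
          X.scalars L _ l₁ * (g₂ - X.scalars L _ l₂) := by
        rw [map_mul]; ring
      rw [this]
      exact J.add_mem (J.mul_mem_right _ h₁) (J.mul_mem_left _ h₂)
  intro g hg
  obtain ⟨l, hl⟩ := hmem g
  have h0 : ((X.ptL L).app (X.pr₁ L ⁻¹ᵁ V)).hom (X.scalars L _ l) = 0 := by
    have h1 := hJle hl
    rw [RingHom.mem_ker, map_sub, RingHom.mem_ker.1 hg, zero_sub, neg_eq_zero] at h1
    exact h1
  have hl0 : l = 0 :=
    eq_zero_of_app_constants_eq_zero (X.ptL_pr₂ L) (X.inftyL_mem_preimage L hV) h0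
  rwa [hl0, map_zero, sub_zero] at hl

variable {L} in
/-- A uniformizer at `∞` which is the pullback of a function on `C`. -/
structure Uniformizer where
  V : X.C.Opens
  a : Γ(X.C, V)
  mem : X.inftyL L ∈ X.pr₁ L ⁻¹ᵁ V
  app_ptL : ((X.ptL L).app (X.pr₁ L ⁻¹ᵁ V)).hom (((X.pr₁ L).app V).hom a) = 0
  span_eq : IsLocalRing.maximalIdeal ((X.CL L).presheaf.stalk (X.inftyL L)) =
    Ideal.span {germFun mem (((X.pr₁ L).app V).hom a)}

/-- The pulled-back functions vanishing at ∞ generate the maximal ideal, and in a discrete valuation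
ring some member of a generating set already generates it. Descending the uniformizer to C is what
makes it σ-invariant. -/
theorem nonempty_uniformizer : Nonempty (X.Uniformizer (L := L)) := by
  obtain ⟨_, ⟨V, hVa, rfl⟩, hV, -⟩ := X.C.isBasis_affineOpens.exists_subset_of_mem_open
    (Set.mem_univ (X.pt (IsLocalRing.closedPoint k))) isOpen_univ
  have : IsAffineHom (X.pr₁ L) :=
    (inferInstance : MorphismProperty.IsStableUnderBaseChange @IsAffineHom.{u}).of_isPullback
      (IsPullback.of_hasPullback X.π (Spec.map (CommRingCat.ofHom (algebraMap k L)))).flip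
      inferInstance
  have hWa : IsAffineOpen (X.pr₁ L ⁻¹ᵁ V) := hVa.preimage _
  have hmem := X.inftyL_mem_preimage L hV
  have hm : IsLocalRing.maximalIdeal ((X.CL L).presheaf.stalk (X.inftyL L)) =
      Ideal.span (germFun hmem '' (((X.pr₁ L).app V).hom '' RingHom.ker (X.pt.app V).hom)) := by
    rw [← Ideal.map_span]
    refine (maximalIdeal_eq_map_ker (X.ptL L) hWa hmem).trans (le_antisymm ?_ ?_)
    · exact Ideal.map_mono (X.ker_ptL_le_span L hVa hV)
    · refine Ideal.map_mono ?_
      rw [Ideal.span_le]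
      rintro _ ⟨b, hb, rfl⟩
      exact app_eq_zero_of_comp_eq (X.ptL_pr₁ L) hb
  obtain ⟨_, ⟨_, ⟨a, ha, rfl⟩, rfl⟩, hspan⟩ := exists_mem_maximalIdeal_eq_span hm
  exact ⟨⟨V, a, hmem, app_eq_zero_of_comp_eq (X.ptL_pr₁ L) ha, hspan⟩⟩

namespace Uniformizer

variable {X L} (t : X.Uniformizer (L := L))

/-- The domain of definition of the uniformizer. -/
abbrev domain : (X.CL L).Opens := X.pr₁ L ⁻¹ᵁ t.V

/-- The uniformizer as a section. -/
abbrev sec : Γ(X.CL L, t.domain) := ((X.pr₁ L).app t.V).hom t.a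

/-- The uniformizer as an element of the local ring. -/
abbrev germ : (X.CL L).presheaf.stalk (X.inftyL L) := germFun t.mem t.sec

lemma germ_irreducible : Irreducible t.germ :=
  (IsDiscreteValuationRing.irreducible_iff_uniformizer _).2 t.span_eq

lemma res_mem_ideal {U : (X.CL L).affineOpens} (h : U.1 ≤ t.domain) :
    resFun h t.sec ∈ (X.ptL L).ker.ideal U := by
  rw [Scheme.Hom.ker_apply, RingHom.mem_ker]
  have h1 : ((X.CL L).presheaf.map (homOfLE h).op ≫ (X.ptL L).app U.1).hom t.sec =
      ((X.ptL L).app t.domain ≫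
        (Spec (.of L)).presheaf.map (((Opens.map (X.ptL L).base).map (homOfLE h)).op)).hom t.sec := by
    rw [Scheme.Hom.naturality]; rfl
  refine h1.trans ?_
  exact (congrArg ((Spec (.of L)).presheaf.map
    ((Opens.map (X.ptL L).base).map (homOfLE h)).op).hom t.app_ptL).trans (RingHom.map_zero _)

end Uniformizer

lemma germFun_mem_maximalIdeal_of_mem_ideal {U : (X.CL L).affineOpens} (hU : X.inftyL L ∈ U.1)
    {a : Γ(X.CL L, U.1)} (ha : a ∈ (X.ptL L).ker.ideal U) :
    germFun hU a ∈ IsLocalRing.maximalIdeal ((X.CL L).presheaf.stalk (X.inftyL L)) := by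
  rw [Scheme.Hom.ker_apply] at ha
  exact (germFun_mem_maximalIdeal_iff (X.ptL L) hU a).2 ha

end PointedCurve

/-! ### Morphisms with image I^k · G, and composites of the Π's -/

section Images

variable {Y : Scheme.{u}}

lemma appSec_injective {F G : Y.Modules} (f : F ⟶ G) [Mono f] (U : Y.Opens) :
    Function.Injective (appSec f U) := by
  have h1 : Mono ((Scheme.Modules.toPresheaf Y).map f) := inferInstance
  have h2 := (NatTrans.mono_iff_mono_app _).1 h1 (.op U)
  exact (AddCommGrpCat.mono_iff_injective _).1 h2

/-- The linear map on sections given by a morphism of sheaves of modules. -/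
def appLin {F G : Y.Modules} (f : F ⟶ G) (U : Y.Opens) : Γ(F, U) →ₗ[Γ(Y, U)] Γ(G, U) where
  toFun := appSec f U
  map_add' := map_add _
  map_smul' a s := appSec_smul f a s

lemma hasImagePowMul_iff {I : Y.IdealSheafData} {k : ℕ} {F G : Y.Modules} {f : F ⟶ G} :
    HasImagePowMul I k f ↔ ∀ U : Y.affineOpens,
      LinearMap.range (appLin f U.1) = I.ideal U ^ k • (⊤ : Submodule Γ(Y, U.1) Γ(G, U.1)) := by
  refine forall_congr' fun U => ?_
  rw [SetLike.ext_iff]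
  rfl

/-- By linearity g(I^m G) = I^m g(G) = I^m I^n H. -/
lemma HasImagePowMul.comp {I : Y.IdealSheafData} {m n : ℕ} {F G H : Y.Modules} {f : F ⟶ G}
    {g : G ⟶ H} (hf : HasImagePowMul I m f) (hg : HasImagePowMul I n g) :
    HasImagePowMul I (m + n) (f ≫ g) := by
  rw [hasImagePowMul_iff] at *
  intro U
  have h : appLin (f ≫ g) U.1 = appLin g U.1 ∘ₗ appLin f U.1 := rfl
  rw [h, LinearMap.range_comp, hf, Submodule.map_smul'', Submodule.map_top, hg, ← mul_smul,
    ← pow_add]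

lemma hasImagePowMul_id (I : Y.IdealSheafData) (F : Y.Modules) :
    HasImagePowMul I 0 (𝟙 F) := by
  rw [hasImagePowMul_iff]
  intro U
  rw [pow_zero, Ideal.one_eq_top, Submodule.top_smul]
  exact LinearMap.range_eq_top.2 fun s => ⟨s, rfl⟩

variable {F G : ℤ → Y.Modules} {P : ∀ i, F i ⟶ F (i + 1)} {Q : ∀ i, G i ⟶ G (i + 1)}

lemma shift_eq_add (i : ℤ) (n : ℕ) : shift i n = i + n := by
  induction n with
  | zero => simp [shift]
  | succ n ih => rw [shift, ih]; push_cast; ring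

lemma shift_shift (i : ℤ) (m n : ℕ) : shift (shift i m) n = shift i (m + n) := by
  simp only [shift_eq_add]; push_cast; ring

lemma eqToHom_comp_family {p q : ℤ} (h : p = q) :
    eqToHom (congrArg F h) ≫ P q = P p ≫ eqToHom (by rw [h]) := by
  subst h; simp

/-- The transport is needed because the two target indices agree only propositionally for general n.
-/
lemma chain_add (i : ℤ) (m n : ℕ) : chain P i (m + n) =
    chain P i m ≫ chain P (shift i m) n ≫ eqToHom (congrArg F (shift_shift i m n)) := by
  induction n with
  | zero => simp [chain, shift]
  | succ n ih =>
    change chain P i (m + n) ≫ P (shift i (m + n)) = _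
    rw [ih, Category.assoc, Category.assoc, eqToHom_comp_family (shift_shift i m n)]
    exact congrArg (chain P i m ≫ ·) (Category.assoc _ _ _).symm

lemma HasImagePowMul.comp_eqToHom {I : Y.IdealSheafData} {m : ℕ} {F G H : Y.Modules}
    {f : F ⟶ G} (hf : HasImagePowMul I m f) (h : G = H) : HasImagePowMul I m (f ≫ eqToHom h) := by
  subst h; simpa using hf

lemma hasImagePowMul_chain_mul {I : Y.IdealSheafData} {n l : ℕ}
    (h : ∀ i, HasImagePowMul I n (chain P i l)) (i : ℤ) (m : ℕ) :
    HasImagePowMul I (n * m) (chain P i (l * m)) := by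
  induction m with
  | zero => exact hasImagePowMul_id I _
  | succ m ih =>
    rw [Nat.mul_succ, Nat.mul_succ, chain_add]
    exact ih.comp ((h _).comp_eqToHom _)

lemma chain_comp_hom (f : ∀ i, F i ⟶ G i) (hf : ∀ i, P i ≫ f (i + 1) = f i ≫ Q i) (i : ℤ)
    (m : ℕ) : chain P i m ≫ f (shift i m) = f i ≫ chain Q i m := by
  induction m with
  | zero => simp [chain, shift]
  | succ m ih =>
    change (chain P i m ≫ P _) ≫ f (shift i m + 1) = f i ≫ chain Q i m ≫ Q _
    rw [Category.assoc, hf, ← Category.assoc, ih, Category.assoc]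

lemma mono_chain (hP : ∀ i, Mono (P i)) (i : ℤ) (m : ℕ) : Mono (chain P i m) := by
  induction m with
  | zero => exact inferInstanceAs (Mono (𝟙 _))
  | succ m ih =>
    have := hP (shift i m)
    exact inferInstanceAs (Mono (chain P i m ≫ P _))

lemma IsFrame.exists_eq_sum_of_mem_smul {F : Y.Modules} {U : Y.Opens} {r : ℕ}
    {b : Fin r → Γ(F, U)} (hb : IsFrame b) {J : Ideal Γ(Y, U)} {s : Γ(F, U)}
    (hs : s ∈ J • (⊤ : Submodule Γ(Y, U) Γ(F, U))) :
    ∃ a : Fin r → Γ(Y, U), (∀ j, a j ∈ J) ∧ s = ∑ j, a j • b j := by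
  induction hs using Submodule.smul_induction_on' with
  | smul c hc x _ =>
    obtain ⟨a, rfl⟩ := hb.exists_eq_sum x
    exact ⟨fun j => c * a j, fun j => J.mul_mem_right _ hc, by
      rw [Finset.smul_sum]; simp only [mul_smul]⟩
  | add x _ y _ hx hy =>
    obtain ⟨a, ha, rfl⟩ := hx
    obtain ⟨a', ha', rfl⟩ := hy
    exact ⟨fun j => a j + a' j, fun j => J.add_mem (ha j) (ha' j), by
      simp only [add_smul, Finset.sum_add_distrib]⟩

lemma IsFrame.sum_injective {F : Y.Modules} {U : Y.Opens} {r : ℕ} {b : Fin r → Γ(F, U)}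
    (hb : IsFrame b) {a a' : Fin r → Γ(Y, U)} (h : ∑ j, a j • b j = ∑ j, a' j • b j) : a = a' := by
  apply (hb U le_rfl).1
  have : ∀ s, resSec F (le_refl U) s = s := fun s => congr($(F.presheaf.map_id _).hom s)
  simpa only [this] using h

end Images

/-- In a discrete valuation ring, an element divisible by all powers of a uniformizer is zero. -/
lemma eq_zero_of_forall_pow_mul_eq {O : Type*} [CommRing O] [IsDomain O]
    [IsDiscreteValuationRing O] {ϖ g : O} (hϖ : Irreducible ϖ) {a b : ℕ} (hab : a < b)
    (h : ∀ s : ℕ, ϖ ^ (b * s) ∣ ϖ ^ (a * s) * g) : g = 0 := by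
  by_contra hg
  obtain ⟨m, u, rfl⟩ := IsDiscreteValuationRing.eq_unit_mul_pow_irreducible hg hϖ
  -- With m the valuation of g, taking s = m + 1 would give b(m+1) ≤ a(m+1) + m, impossible as b ≥ a
  -- + 1.
  have h1 := h (m + 1)
  rw [mul_left_comm, ← pow_add, Units.dvd_mul_left,
    pow_dvd_pow_iff hϖ.ne_zero hϖ.not_isUnit] at h1
  nlinarith

/-! ### Vanishing of morphisms between periodic families -/

namespace PointedCurve

variable {k : Type u} [Field k] {X : PointedCurve k} {L : Type u} [Field L] [Algebra k L]

/-- The coordinates of a section of a locally free sheaf with infinitely many zeros at `∞`, up to a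
smaller order of poles, vanish. -/
lemma eq_zero_of_pow_smul_mem {F : (X.CL L).Modules} {U : (X.CL L).affineOpens}
    (t : X.Uniformizer (L := L)) (hUt : U.1 ≤ t.domain) (hU : X.inftyL L ∈ U.1) {r : ℕ}
    {b : Fin r → Γ(F, U.1)} (hb : IsFrame b) {m n : ℕ} (hmn : m < n) {s : Γ(F, U.1)}
    (h : ∀ e : ℕ, ∀ c ∈ (X.ptL L).ker.ideal U ^ (m * e),
      c • s ∈ (X.ptL L).ker.ideal U ^ (n * e) • (⊤ : Submodule Γ(X.CL L, U.1) Γ(F, U.1))) :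
    s = 0 := by
  obtain ⟨a, rfl⟩ := hb.exists_eq_sum s
  have ha : a = 0 := by
    funext j
    apply germ_injective_of_isIntegral _ (X.inftyL L) hU
    refine Eq.trans ?_ (map_zero (germFun hU)).symm
    refine eq_zero_of_forall_pow_mul_eq (g := germFun hU (a j)) t.germ_irreducible hmn fun e => ?_
    obtain ⟨a', ha', hs⟩ := hb.exists_eq_sum_of_mem_smul
      (h e _ (Ideal.pow_mem_pow (t.res_mem_ideal hUt) (m * e)))
    have h1 : (fun j => resFun hUt t.sec ^ (m * e) * a j) = a' := by
      apply hb.sum_injective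
      rw [← hs, Finset.smul_sum]
      simp only [mul_smul]
    have h2 := ha' j
    rw [← h1] at h2
    have h3 : germFun hU (resFun hUt t.sec ^ (m * e) * a j) ∈
        IsLocalRing.maximalIdeal ((X.CL L).presheaf.stalk (X.inftyL L)) ^ (n * e) := by
      have h4 : ((X.ptL L).ker.ideal U).map (germFun hU) ≤
          IsLocalRing.maximalIdeal ((X.CL L).presheaf.stalk (X.inftyL L)) :=
        Ideal.map_le_iff_le_comap.2 fun c hc => X.germFun_mem_maximalIdeal_of_mem_ideal L hU hc
      refine Ideal.pow_right_mono h4 _ ?_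
      rw [← Ideal.map_pow]
      exact Ideal.mem_map_of_mem _ h2
    rw [t.span_eq, Ideal.span_singleton_pow, Ideal.mem_span_singleton, map_mul, map_pow,
      germFun_res] at h3
    exact h3
  simp [ha]

/-- A family of morphisms commuting with the `Π`'s between two periodic families of locally free
sheaves vanishes unless the periods agree. -/
theorem hom_eq_zero_of_periodic {F G : ℤ → (X.CL L).Modules} {P : ∀ i, F i ⟶ F (i + 1)}
    {Q : ∀ i, G i ⟶ G (i + 1)} {r r' : ℕ} (hF : ∀ i, IsLocallyFreeOfRank (F i) r)
    (hG : ∀ i, IsLocallyFreeOfRank (G i) r') (hQ : ∀ i, Mono (Q i)) {n l n' l' : ℕ}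
    (hPn : ∀ i, HasImagePowMul (X.ptL L).ker n (chain P i l))
    (hQn : ∀ i, HasImagePowMul (X.ptL L).ker n' (chain Q i l'))
    (f : ∀ i, F i ⟶ G i) (hf : ∀ i, P i ≫ f (i + 1) = f i ≫ Q i)
    (hne : n * l' ≠ n' * l) (i : ℤ) : f i = 0 := by
  obtain ⟨t⟩ := X.nonempty_uniformizer L
  obtain ⟨W, hW, b, hb⟩ := (hF i).exists_frame (X.inftyL L)
  obtain ⟨W', hW', b', hb'⟩ := (hG i).exists_frame (X.inftyL L)
  obtain ⟨_, ⟨U, hUa, rfl⟩, hU, hUle⟩ := (X.CL L).isBasis_affineOpens.exists_subset_of_mem_open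
    (show X.inftyL L ∈ (W ⊓ W' ⊓ t.domain : (X.CL L).Opens) from ⟨⟨hW, hW'⟩, t.mem⟩)
    (W ⊓ W' ⊓ t.domain).isOpen
  have hUW : U ≤ W := fun x hx => (hUle hx).1.1
  have hUW' : U ≤ W' := fun x hx => (hUle hx).1.2
  have hUt : U ≤ t.domain := fun x hx => (hUle hx).2
  refine hom_eq_zero_of_isFrame (f i) (hG i) hU (hb.res hUW) fun j => ?_
  generalize resSec (F i) hUW (b j) = x
  let U' : (X.CL L).affineOpens := ⟨U, hUa⟩
  let I := (X.ptL L).ker.ideal U'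
  have hP' : ∀ (i : ℤ) (e : ℕ), LinearMap.range (appLin (chain P i (l * (l' * e))) U) =
      I ^ (n * l' * e) • ⊤ := fun i e => by
    have := hasImagePowMul_iff.1 (hasImagePowMul_chain_mul hPn i (l' * e)) U'
    rwa [← mul_assoc n] at this
  -- Both composites are taken of the same length l l' e, a multiple of either period.
  have hQ' : ∀ (i : ℤ) (e : ℕ), LinearMap.range (appLin (chain Q i (l * (l' * e))) U) =
      I ^ (n' * l * e) • ⊤ := fun i e => by
    have h : ∀ m, m = l' * (l * e) → LinearMap.range (appLin (chain Q i m) U) =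
        I ^ (n' * (l * e)) • ⊤ := by
      rintro m rfl
      exact hasImagePowMul_iff.1 (hasImagePowMul_chain_mul hQn i (l * e)) U'
    rw [mul_assoc n']
    exact h _ (by ring)
  have hcomm : ∀ (i : ℤ) (m : ℕ) (x : Γ(F i, U)), appLin (f (shift i m)) U
      (appLin (chain P i m) U x) = appLin (chain Q i m) U (appLin (f i) U x) := fun i m x =>
    congrArg (fun g => appLin g U x) (chain_comp_hom f hf i m)
  rcases lt_or_gt_of_ne hne with hlt | hlt
  · refine eq_zero_of_pow_smul_mem (U := U') t hUt hU (hb'.res hUW') hlt fun e c hc => ?_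
    have key : ∀ (i₀ : ℤ) (x : Γ(F (shift i₀ (l * (l' * e))), U)),
        c • appLin (f _) U x ∈ I ^ (n' * l * e) • (⊤ : Submodule Γ(X.CL L, U) Γ(G _, U)) := by
      intro i₀ x
      rw [← map_smul]
      have h1 : c • x ∈ LinearMap.range (appLin (chain P i₀ (l * (l' * e))) U) := by
        rw [hP']
        exact Submodule.smul_mem_smul hc trivial
      obtain ⟨y, hy⟩ := h1
      rw [← hy, hcomm, ← hQ']
      exact ⟨_, rfl⟩
    -- The target index is generalised so that the composite can start at i - l l' e and end at i,
    -- an equality that is only propositional.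
    have key' : ∀ (i₀ i₁ : ℤ), shift i₀ (l * (l' * e)) = i₁ → ∀ (x : Γ(F i₁, U)),
        c • appLin (f _) U x ∈ I ^ (n' * l * e) • (⊤ : Submodule Γ(X.CL L, U) Γ(G _, U)) := by
      rintro i₀ _ rfl
      exact key i₀
    exact key' (i - (l * (l' * e) : ℕ)) i (by rw [shift_eq_add]; ring) x
  -- No poles are needed in this case (m = 0): f x itself lies in I^{(nl'-n'l)e} G for every e,
  -- after cancelling the injective composite of the Q's.
  · refine eq_zero_of_pow_smul_mem (U := U') t hUt hU (hb'.res hUW') (Nat.sub_pos_of_lt hlt)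
      fun e c _ => ?_
    refine Submodule.smul_mem _ c ?_
    have := mono_chain hQ i (l * (l' * e))
    have hinj : Function.Injective (appLin (chain Q i (l * (l' * e))) U) :=
      appSec_injective (chain Q i (l * (l' * e))) U
    have h1 : appLin (chain Q i (l * (l' * e))) U (appLin (f i) U x) ∈
        I ^ (n * l' * e) • (⊤ : Submodule Γ(X.CL L, U) Γ(G _, U)) := by
      rw [← hcomm]
      have h2 : appLin (chain P i (l * (l' * e))) U x ∈
          I ^ (n * l' * e) • (⊤ : Submodule Γ(X.CL L, U) Γ(F _, U)) := by
        rw [← hP']; exact ⟨_, rfl⟩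
      have h3 := Submodule.mem_map_of_mem (f := appLin (f (shift i (l * (l' * e)))) U) h2
      rw [Submodule.map_smul''] at h3
      exact Submodule.smul_mono le_rfl le_top h3
    have h4 : I ^ (n * l' * e) = I ^ ((n * l' - n' * l) * e) * I ^ (n' * l * e) := by
      rw [← pow_add, ← add_mul, Nat.sub_add_cancel hlt.le]
    rw [h4, mul_smul, ← hQ', ← Submodule.map_top, ← Submodule.map_smul''] at h1
    obtain ⟨z, hz, hz'⟩ := h1
    change appLin (f i) U x ∈ _
    rw [← hinj hz']
    exact hz

end PointedCurve

/-! ### Abelian τ-sheaves: equality of weights -/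

section AbelianTauSheaf

variable {k : Type u} [Field k] {X : PointedCurve k} {L : Type u} [Field L] [Algebra k L]

lemma rank_ne_zero_of_hom_ne_zero {F G : (X.CL L).Modules} {r r' : ℕ}
    (hF : IsLocallyFreeOfRank F r) (hG : IsLocallyFreeOfRank G r') {f : F ⟶ G} (hf : f ≠ 0) :
    r ≠ 0 ∧ r' ≠ 0 := by
  obtain ⟨W, hW, b, hb⟩ := hF.exists_frame (eta X L)
  refine ⟨?_, ?_⟩
  · rintro rfl
    exact hf (hom_eq_zero_of_isFrame f hG hW hb fun j => j.elim0)
  · rintro rfl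
    obtain ⟨W', hW', b', hb'⟩ := hG.exists_frame (eta X L)
    refine hf (hom_eq_zero_of_isFrame f hG hW hb fun j => ?_)
    refine eq_zero_of_germSec_genericPoint hG _ fun hη => ?_
    obtain ⟨a, ha⟩ := (hb'.germ_bijective hW').2 (germSec G hη (appSec f W (b j)))
    rw [← ha]
    simp

theorem AbelianTauSheaf.weight_eq_of_hom_ne_zero [Finite k] {c : Spec (.of L) ⟶ X.C}
    {hc : c ≫ X.π = Spec.map (CommRingCat.ofHom (algebraMap k L))} {r d r' d' : ℕ}
    {S : AbelianTauSheaf X c hc r d} {S' : AbelianTauSheaf X c hc r' d'} (f : S.Hom S') {i : ℤ}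
    (hf : f.map i ≠ 0) : S.weight = S'.weight := by
  obtain ⟨hr, hr'⟩ := rank_ne_zero_of_hom_ne_zero (S.locallyFree i) (S'.locallyFree i) hf
  obtain ⟨n, l, hn, hl, hld, hP⟩ := S.periodic
  obtain ⟨n', l', hn', hl', hld', hP'⟩ := S'.periodic
  have h : n * l' = n' * l := by
    by_contra hne
    exact hf (PointedCurve.hom_eq_zero_of_periodic S.locallyFree S'.locallyFree S'.P_injective hP
      hP' f.map f.comm_P hne i)
  have h1 : (d : ℚ) / r = n / l := by
    rw [div_eq_div_iff (by positivity) (by positivity)]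
    exact_mod_cast (by linarith : d * l = n * r)
  have h2 : (d' : ℚ) / r' = n' / l' := by
    rw [div_eq_div_iff (by positivity) (by positivity)]
    exact_mod_cast (by linarith : d' * l' = n' * r')
  rw [AbelianTauSheaf.weight, AbelianTauSheaf.weight, if_neg hr, if_neg hr', h1, h2,
    div_eq_div_iff (by positivity) (by positivity)]
  exact_mod_cast h

end AbelianTauSheaf

/-! ### The action of σ on local rings -/

section StalkEndo

variable {Y : Scheme.{u}} {f : Y ⟶ Y} {x : Y}

lemma stalkEndo_germFun (h : f x = x) {U : Y.Opens} (hx : x ∈ U) (s : Γ(Y, U)) :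
    stalkEndo f x h (germFun hx s) =
      germFun (show x ∈ f ⁻¹ᵁ U from (show f x ∈ U from h.symm ▸ hx)) ((f.app U).hom s) := by
  change (f.stalkMap x).hom ((Y.presheaf.stalkSpecializes _).hom (germFun hx s)) = _
  rw [stalkSpecializes_germFun]
  exact congr($(f.germ_stalkMap U x (show f x ∈ U from h.symm ▸ hx)).hom s)

lemma stalkSpecializes_stalkEndo {y : Y} (hyx : y ⤳ x) (hx : f x = x) (hy : f y = y)
    (a : Y.presheaf.stalk x) :
    (Y.presheaf.stalkSpecializes hyx).hom (stalkEndo f x hx a) =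
      stalkEndo f y hy ((Y.presheaf.stalkSpecializes hyx).hom a) := by
  obtain ⟨U, -, hU, a, rfl⟩ := exists_germFun_eq (U := ⊤) (x := x) trivial a
  rw [stalkEndo_germFun, stalkSpecializes_germFun, stalkSpecializes_germFun, stalkEndo_germFun]

instance isLocalHom_stalkEndo (h : f x = x) : IsLocalHom (stalkEndo f x h) := by
  have : IsIso (Y.presheaf.stalkSpecializes (specializes_of_eq h)) := by
    refine ⟨Y.presheaf.stalkSpecializes (specializes_of_eq h.symm), ?_, ?_⟩
    · rw [TopCat.Presheaf.stalkSpecializes_comp]; exact TopCat.Presheaf.stalkSpecializes_refl _ _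
    · rw [TopCat.Presheaf.stalkSpecializes_comp]; exact TopCat.Presheaf.stalkSpecializes_refl _ _
  exact inferInstanceAs (IsLocalHom (Y.presheaf.stalkSpecializes (specializes_of_eq h) ≫
    f.stalkMap x).hom)

/-- Functions pulled back along g are f-invariant. Applied to σ and the projection to C, it yields
the invariance of the uniformizer. -/
lemma stalkEndo_germFun_app {Z : Scheme.{u}} (h : f x = x) {g : Y ⟶ Z} (hg : f ≫ g = g)
    {V : Z.Opens} (hx : x ∈ g ⁻¹ᵁ V) (a : Γ(Z, V)) :
    stalkEndo f x h (germFun hx ((g.app V).hom a)) = germFun hx ((g.app V).hom a) := by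
  rw [stalkEndo_germFun]
  have key : ∀ (g' : Y ⟶ Z) (_ : g' = g) (hx' : x ∈ g' ⁻¹ᵁ V),
      germFun hx' ((g'.app V).hom a) = germFun hx ((g.app V).hom a) := by
    rintro _ rfl _
    rfl
  exact key _ hg _

end StalkEndo

namespace PointedCurve

variable {k : Type u} [Field k] (X : PointedCurve k) {L : Type u} [Field L] [Algebra k L]

instance fieldGeneric : Field ((X.CL L).presheaf.stalk (eta X L)) :=
  inferInstanceAs (Field (X.CL L).functionField)

lemma isFractionRing_toGeneric :
    letI := (toGeneric X L).toAlgebra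
    IsFractionRing ((X.CL L).presheaf.stalk (X.inftyL L))
      ((X.CL L).presheaf.stalk (eta X L)) :=
  inferInstanceAs (IsFractionRing ((X.CL L).presheaf.stalk (X.inftyL L)) (X.CL L).functionField)

lemma toGeneric_injective : Function.Injective (toGeneric X L) :=
  letI := (toGeneric X L).toAlgebra
  have := X.isFractionRing_toGeneric (L := L)
  IsFractionRing.injective _ _

/-- Every denominator in the fraction field is a unit times a power of ϖ. This bounds the poles of a
linear map between lattices. -/
lemma exists_pow_mul_mem_range {ϖ : (X.CL L).presheaf.stalk (X.inftyL L)} (hϖ : Irreducible ϖ)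
    (κ : (X.CL L).presheaf.stalk (eta X L)) :
    ∃ N : ℕ, toGeneric X L ϖ ^ N * κ ∈ (toGeneric X L).range := by
  let := (toGeneric X L).toAlgebra
  have := X.isFractionRing_toGeneric (L := L)
  obtain ⟨p, q, hq, rfl⟩ := IsFractionRing.div_surjective
    (A := (X.CL L).presheaf.stalk (X.inftyL L)) κ
  obtain ⟨m, v, rfl⟩ := IsDiscreteValuationRing.eq_unit_mul_pow_irreducible
    (nonZeroDivisors.ne_zero hq) hϖ
  refine ⟨m, ↑v⁻¹ * p, ?_⟩
  have h0 : toGeneric X L ϖ ≠ 0 :=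
    (map_ne_zero_iff _ X.toGeneric_injective).2 hϖ.ne_zero
  have hv : toGeneric X L ↑v⁻¹ * toGeneric X L v = 1 := by
    rw [← map_mul, Units.inv_mul, map_one]
  have hv0 : toGeneric X L v ≠ 0 := right_ne_zero_of_mul_eq_one hv
  change _ = toGeneric X L ϖ ^ m * (toGeneric X L p / toGeneric X L (v * ϖ ^ m))
  rw [map_mul, map_mul, map_pow, eq_inv_of_mul_eq_one_left hv]
  field_simp

variable [Finite k]

lemma σ_pr₁ : X.σ L ≫ X.pr₁ L = X.pr₁ L :=
  (Limits.pullback.lift_fst _ _ _).trans (Category.comp_id _)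

variable {X} in
lemma Uniformizer.stalkEndo_germ (t : X.Uniformizer (L := L)) :
    stalkEndo (X.σ L) (X.inftyL L) X.σ_inftyL t.germ = t.germ :=
  stalkEndo_germFun_app X.σ_inftyL X.σ_pr₁ t.mem t.a

lemma toGeneric_stalkEndo (a : (X.CL L).presheaf.stalk (X.inftyL L)) :
    toGeneric X L (stalkEndo (X.σ L) (X.inftyL L) X.σ_inftyL a) =
      stalkEndo (X.σ L) (eta X L) X.σ_genericPoint (toGeneric X L a) :=
  stalkSpecializes_stalkEndo _ _ _ _

end PointedCurve

/-! ### Pure tensors and semilinear maps -/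

section ExtendScalars

variable {R S : Type u} [CommRing R] [CommRing S] (f : R →+* S)

lemma extendScalars_induction {M : ModuleCat.{u} R}
    {p : (ModuleCat.extendScalars f).obj M → Prop} (h0 : p 0)
    (hsmul : ∀ (b : S) (m : M), p (b • oneTmul f M m)) (hadd : ∀ x y, p x → p y → p (x + y))
    (x : (ModuleCat.extendScalars f).obj M) : p x := by
  let : Module R S := Module.compHom S f
  have h : ∀ y : S ⊗[R] M, p y := fun y => by
    induction y with
    | zero => exact h0
    | add y z hy hz => exact hadd y z hy hz
    | tmul b m =>
      have h : b • oneTmul f M m = (b ⊗ₜ[R] m : S ⊗[R] M) :=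
        (ModuleCat.ExtendScalars.smul_tmul f b 1 m).trans (by rw [mul_one])
      rw [← h]
      exact hsmul b m
  exact h x

/-- The `S`-linear map `S ⊗ M → N` extending a semilinear map `M → N`. -/
lemma exists_extendScalars_lift {M : ModuleCat.{u} R} {N : ModuleCat.{u} S} (g : M →+ N)
    (hg : ∀ (a : R) (m : M), g (a • m) = f a • g m) :
    ∃ G : (ModuleCat.extendScalars f).obj M →ₗ[S] N, ∀ m, G (oneTmul f M m) = g m := by
  let g' : M ⟶ (ModuleCat.restrictScalars f).obj N := ModuleCat.ofHom
    (Y := (ModuleCat.restrictScalars f).obj N) { g with map_smul' := hg }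
  refine ⟨(((ModuleCat.extendRestrictScalarsAdj f).homEquiv M N).symm g').hom, fun m => ?_⟩
  have h := ((ModuleCat.extendRestrictScalarsAdj f).homEquiv M N).apply_symm_apply g'
  rw [Adjunction.homEquiv_unit] at h
  exact congr($(h).hom m)

end ExtendScalars

/-! ### Lattices with a twisted semilinear map, and their slopes -/

/-- A lattice `D` over `O` in a vector space `V` over a larger ring `K`. -/
structure Lattice {O K : Type*} [CommRing O] [CommRing K] (ι : O →+* K) (D V : Type*)
    [AddCommGroup D] [Module O D] [AddCommGroup V] [Module K V] where
  r : ℕ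
  incl : D →+ V
  incl_smul : ∀ a x, incl (a • x) = ι a • incl x
  basis : Module.Basis (Fin r) O D
  basisK : Module.Basis (Fin r) K V
  basisK_apply : ∀ i, basisK i = incl (basis i)

namespace Lattice

section Basic

variable {O K : Type*} [CommRing O] [CommRing K] {ι : O →+* K} {D V : Type*}
  [AddCommGroup D] [Module O D] [AddCommGroup V] [Module K V] (Λ : Lattice ι D V)

/-- The image of the lattice as a submodule. -/
def sub : Submodule ι.range V where
  carrier := Set.range Λ.incl
  zero_mem' := ⟨0, map_zero _⟩
  add_mem' := by rintro _ _ ⟨x, rfl⟩ ⟨y, rfl⟩; exact ⟨x + y, map_add _ _ _⟩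
  smul_mem' := by rintro ⟨_, a, rfl⟩ _ ⟨x, rfl⟩; exact ⟨a • x, Λ.incl_smul a x⟩

lemma incl_eq_sum (x : D) : Λ.incl x = ∑ i, ι (Λ.basis.repr x i) • Λ.basisK i := by
  conv_lhs => rw [← Λ.basis.sum_repr x]
  simp only [map_sum, Λ.incl_smul, Λ.basisK_apply]

lemma incl_injective (hι : Function.Injective ι) : Function.Injective Λ.incl := by
  refine (injective_iff_map_eq_zero _).2 fun x hx => ?_
  rw [incl_eq_sum] at hx
  have h := Fintype.linearIndependent_iff.1 Λ.basisK.linearIndependent _ hx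
  exact Λ.basis.repr.map_eq_zero_iff.1 (Finsupp.ext fun i => hι ((h i).trans (map_zero ι).symm))

lemma exists_eq_smul {ϖ : O} {x : D} (h : ∀ i, ϖ ∣ Λ.basis.repr x i) : ∃ z, x = ϖ • z := by
  choose c hc using h
  refine ⟨∑ i, c i • Λ.basis i, ?_⟩
  rw [Finset.smul_sum]
  simp only [← mul_smul, ← hc]
  exact (Λ.basis.sum_repr x).symm

lemma eq_zero_of_forall_mem {V' : Type*} [AddCommGroup V'] [Module K V'] (g : V →ₗ[K] V')
    (hg : ∀ x ∈ Λ.sub, g x = 0) : g = 0 :=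
  Λ.basisK.ext fun i => hg _ ⟨_, (Λ.basisK_apply i).symm⟩

lemma exists_pow_smul_mem {ϖ : O} (hϖ : ∀ κ : K, ∃ N : ℕ, ι ϖ ^ N * κ ∈ ι.range)
    {α : Type*} (s : Finset α) (v : α → V) :
    ∃ N : ℕ, ∀ i ∈ s, ι ϖ ^ N • v i ∈ Λ.sub := by
  have hmono : ∀ (N M : ℕ) (v : V), N ≤ M → ι ϖ ^ N • v ∈ Λ.sub → ι ϖ ^ M • v ∈ Λ.sub := by
    intro N M v hNM h
    obtain ⟨e, rfl⟩ := Nat.exists_eq_add_of_le' hNM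
    rw [pow_add, mul_smul]
    exact Λ.sub.smul_mem ⟨ι ϖ ^ e, ϖ ^ e, map_pow _ _ _⟩ h
  have hone : ∀ v : V, ∃ N : ℕ, ι ϖ ^ N • v ∈ Λ.sub := by
    intro v
    choose N hN using fun i => hϖ (Λ.basisK.repr v i)
    refine ⟨Finset.univ.sup N, ?_⟩
    rw [← Λ.basisK.sum_repr v, Finset.smul_sum]
    refine sum_mem fun i _ => hmono (N i) _ _ (Finset.le_sup (Finset.mem_univ i)) ?_
    rw [smul_smul]
    exact Λ.sub.smul_mem (⟨_, hN i⟩ : ι.range) ⟨_, (Λ.basisK_apply i).symm⟩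
  choose N hN using fun i => hone (v i)
  exact ⟨s.sup N, fun i hi => hmono _ _ _ (Finset.le_sup hi) (hN i)⟩

lemma exists_pow_smul_map_mem {ϖ : O} (hϖ : ∀ κ : K, ∃ N : ℕ, ι ϖ ^ N * κ ∈ ι.range)
    {D' V' : Type*} [AddCommGroup D'] [Module O D'] [AddCommGroup V'] [Module K V']
    (Λ' : Lattice ι D' V') (f : V →ₗ[K] V') :
    ∃ N : ℕ, ∀ x ∈ Λ.sub, ι ϖ ^ N • f x ∈ Λ'.sub := by
  obtain ⟨N, hN⟩ := Λ'.exists_pow_smul_mem hϖ Finset.univ fun i => f (Λ.basisK i)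
  refine ⟨N, ?_⟩
  rintro _ ⟨x, rfl⟩
  rw [incl_eq_sum, map_sum, Finset.smul_sum]
  refine sum_mem fun i _ => ?_
  rw [map_smul, smul_comm]
  exact Λ'.sub.smul_mem ⟨_, Λ.basis.repr x i, rfl⟩ (hN i (Finset.mem_univ i))

lemma eq_zero_of_forall_pow [IsDomain O] [IsDiscreteValuationRing O] {ϖ : O}
    (hϖ : Irreducible ϖ) (hι : Function.Injective ι) (y : V)
    (h : ∀ e : ℕ, ∃ z ∈ Λ.sub, y = ι ϖ ^ e • z) : y = 0 := by
  obtain ⟨_, ⟨x, rfl⟩, hx⟩ := h 0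
  rw [pow_zero, one_smul] at hx
  have hx0 : x = 0 := by
    refine Λ.basis.repr.map_eq_zero_iff.1 (Finsupp.ext fun i => ?_)
    refine eq_zero_of_forall_pow_mul_eq hϖ zero_lt_one fun s => ?_
    obtain ⟨_, ⟨z, rfl⟩, hz⟩ := h s
    rw [hx, ← map_pow, ← Λ.incl_smul] at hz
    rw [Λ.incl_injective hι hz]
    simp
  rw [hx, hx0, map_zero]

end Basic

section Twist

variable {O K : Type u} [CommRing O] [CommRing K] {ι : O →+* K} {D V : Type u}
  [AddCommGroup D] [Module O D] [AddCommGroup V] [Module K V] (Λ : Lattice ι D V)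

/-- The semilinear map `T` induces an isomorphism of the pullback of the lattice along `φ` and the
lattice twisted by `ϖ ^ (-n)`. -/
def IsTwist (ϖ : O) (φ : O →+* O) (T : V → V) (n : ℕ) : Prop :=
  ∃ (H : AddSubgroup V) (θ : (ModuleCat.extendScalars φ).obj (ModuleCat.of O D) ≃+ H),
    (∀ y, y ∈ H ↔ ι ϖ ^ n • y ∈ Λ.sub) ∧
    ∀ (b : O) (x : D), (θ (b • oneTmul φ (ModuleCat.of O D) x) : V) = ι b • T (Λ.incl x)

variable {Λ} {ϖ : O} {ϖ' : K} {φ : O →+* O} {T : V → V} {n : ℕ}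

lemma IsTwist.mem (h : Λ.IsTwist ϖ φ T n) : ∀ y ∈ Λ.sub, ι ϖ ^ n • T y ∈ Λ.sub := by
  obtain ⟨H, θ, hH, hθ⟩ := h
  rintro _ ⟨x, rfl⟩
  have h1 := hθ 1 x
  rw [map_one, one_smul, one_smul] at h1
  rw [← h1]
  exact (hH _).1 (Subtype.prop _)

/-- Surjectivity of θ: each element of the twisted lattice is an O-combination of values of T on Λ;
multiply by ϖ^n. -/
lemma IsTwist.le_span (h : Λ.IsTwist ϖ φ T n) (hϖ : ϖ' * ι ϖ = 1) :
    Λ.sub ≤ Submodule.span ι.range ((fun y => ι ϖ ^ n • T y) '' Λ.sub) := by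
  obtain ⟨H, θ, hH, hθ⟩ := h
  have key : ∀ u, ι ϖ ^ n • (θ u : V) ∈
      Submodule.span ι.range ((fun y => ι ϖ ^ n • T y) '' Λ.sub) := by
    intro u
    induction u using extendScalars_induction with
    | h0 => simp
    | hsmul b x =>
      rw [hθ, smul_comm]
      exact Submodule.smul_mem _ (⟨_, b, rfl⟩ : ι.range) (Submodule.subset_span ⟨_, ⟨x, rfl⟩, rfl⟩)
    | hadd x y hx hy =>
      rw [map_add, AddSubgroup.coe_add, smul_add]
      exact add_mem hx hy
  intro y hy
  have h1 : ι ϖ ^ n • ϖ' ^ n • y = y := by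
    rw [smul_smul, ← mul_pow, mul_comm, hϖ, one_pow, one_smul]
  have h2 := key (θ.symm ⟨ϖ' ^ n • y, (hH _).2 (by rwa [h1])⟩)
  rwa [AddEquiv.apply_symm_apply, h1] at h2

/-- Injectivity of θ turns divisibility of ϖ^n T(x) into divisibility of 1 ⊗ x by ϖ. Then ϖ divides
φ of each coordinate of x, and since φ is local, the coordinates lie in the maximal ideal. -/
lemma IsTwist.exists_eq_smul [IsLocalRing O] (h : Λ.IsTwist ϖ φ T n) (hϖ : ϖ' * ι ϖ = 1)
    (hm : IsLocalRing.maximalIdeal O = Ideal.span {ϖ}) [IsLocalHom φ] :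
    ∀ x ∈ Λ.sub, (∃ z ∈ Λ.sub, ι ϖ ^ n • T x = ι ϖ • z) → ∃ z ∈ Λ.sub, x = ι ϖ • z := by
  obtain ⟨H, θ, hH, hθ⟩ := h
  have hlin : ∀ (c : O) u, (θ (c • u) : V) = ι c • (θ u : V) := by
    intro c u
    induction u using extendScalars_induction with
    | h0 => simp
    | hsmul b x => rw [smul_smul, hθ, hθ, map_mul, mul_smul]
    | hadd x y hx hy =>
      rw [smul_add, map_add, map_add, AddSubgroup.coe_add, AddSubgroup.coe_add, hx, hy, smul_add]
  have h1 : ∀ y : V, ι ϖ ^ n • ϖ' ^ n • y = y := fun y => by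
    rw [smul_smul, ← mul_pow, mul_comm, hϖ, one_pow, one_smul]
  have h1' : ∀ y : V, ϖ' ^ n • ι ϖ ^ n • y = y := fun y => by
    rw [smul_comm, h1]
  rintro _ ⟨x, rfl⟩ ⟨z, hz, hxz⟩
  obtain ⟨u, hu⟩ := θ.surjective ⟨ϖ' ^ n • z, (hH _).2 (by rwa [h1])⟩
  have h2 : (1 : O) • oneTmul φ (ModuleCat.of O D) x = ϖ • u := by
    apply θ.injective
    apply Subtype.ext
    rw [hθ, hlin, hu, map_one, one_smul]
    change T (Λ.incl x) = ι ϖ • ϖ' ^ n • z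
    rw [smul_comm, ← hxz, h1']
  rw [one_smul] at h2
  obtain ⟨w, hw⟩ := Λ.exists_eq_smul (ϖ := ϖ) (x := x) fun i => by
    -- The i-th coordinate of φ^*D, sending 1 ⊗ x to φ(x_i).
    obtain ⟨G, hG⟩ := exists_extendScalars_lift φ (M := ModuleCat.of O D) (N := ModuleCat.of O O)
      (φ.toAddMonoidHom.comp (Λ.basis.coord i).toAddMonoidHom)
      (fun a m => by
        change φ (Λ.basis.coord i (a • m)) = φ a * φ (Λ.basis.coord i m)
        rw [map_smul, smul_eq_mul, map_mul])
    have h3 := hG x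
    rw [h2, map_smul] at h3
    have h4 : φ (Λ.basis.repr x i) ∈ IsLocalRing.maximalIdeal O := by
      rw [hm, Ideal.mem_span_singleton]
      exact ⟨_, h3.symm⟩
    rw [← Ideal.mem_span_singleton, ← hm]
    exact (IsLocalRing.mem_maximalIdeal _).2 (((IsLocalRing.mem_maximalIdeal _).1 h4) ∘ IsUnit.map φ)
  exact ⟨_, ⟨w, rfl⟩, by rw [hw, Λ.incl_smul]⟩

end Twist

end Lattice

lemma isLocalHom_pow {O : Type*} [CommRing O] (φ : O →+* O) [IsLocalHom φ] (m : ℕ) :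
    IsLocalHom (φ ^ m) := by
  induction m with
  | zero => exact ⟨fun _ h => h⟩
  | succ m ih => exact ⟨fun a h => IsUnit.of_map φ a (IsUnit.of_map (φ ^ m) _ h)⟩

namespace Lattice

section ScaledIterate

variable {K V : Type*} [CommRing K] [AddCommGroup V] [Module K V]

/-- The additive map `π ^ n T ^ l`. -/
def scaledIterate (π : K) (n l : ℕ) (T : V →+ V) : V →+ V where
  toFun y := π ^ n • T^[l] y
  map_zero' := by rw [iterate_map_zero, smul_zero]
  map_add' x y := by rw [iterate_map_add, smul_add]

lemma scaledIterate_apply (π : K) (n l : ℕ) (T : V →+ V) (y : V) :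
    scaledIterate π n l T y = π ^ n • T^[l] y := rfl

variable {φ : K →+* K} {T : V →+ V} {π : K}

lemma iterate_smul (hT : ∀ (a : K) y, T (a • y) = φ a • T y) (l : ℕ) (a : K) (y : V) :
    T^[l] (a • y) = (φ ^ l) a • T^[l] y := by
  induction l generalizing y a with
  | zero => rfl
  | succ l ih => rw [Function.iterate_succ_apply, hT, ih]; rfl

lemma pow_apply_eq_self (hπ : φ π = π) (l : ℕ) : (φ ^ l) π = π := by
  induction l with
  | zero => rfl
  | succ l ih => rw [pow_succ, RingHom.mul_def, RingHom.comp_apply, hπ, ih]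

lemma scaledIterate_smul (hT : ∀ (a : K) y, T (a • y) = φ a • T y) (n l : ℕ) (a : K) (y : V) :
    scaledIterate π n l T (a • y) = (φ ^ l) a • scaledIterate π n l T y := by
  rw [scaledIterate_apply, scaledIterate_apply, iterate_smul hT, smul_comm]

/-- Because φ fixes π, powers of π move freely past T and the exponents simply multiply. -/
lemma iterate_scaledIterate (hT : ∀ (a : K) y, T (a • y) = φ a • T y) (hπ : φ π = π)
    (n l m : ℕ) (y : V) :
    (scaledIterate π n l T)^[m] y = π ^ (n * m) • T^[l * m] y := by
  induction m with
  | zero => simp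
  | succ m ih =>
    rw [Function.iterate_succ_apply', ih, scaledIterate_smul hT, scaledIterate_apply, map_pow,
      pow_apply_eq_self hπ, smul_smul, ← pow_add, ← Function.iterate_add_apply]
    congr 2
    ring

end ScaledIterate

variable {O K : Type u} [CommRing O] [IsDomain O] [IsDiscreteValuationRing O] [CommRing K]
  {ι : O →+* K} {D V D' V' : Type u}
  [AddCommGroup D] [Module O D] [AddCommGroup V] [Module K V]
  [AddCommGroup D'] [Module O D'] [AddCommGroup V'] [Module K V']

/-- Two lattices which are isoclinic with respect to semilinear endomorphisms, and whose ambient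
spaces are related by a nonzero linear map commuting with these, have the same slope. -/
theorem slope_eq {Λ : Lattice ι D V} {Λ' : Lattice ι D' V'} (hι : Function.Injective ι) {ϖ : O}
    (hϖ : Irreducible ϖ) {ϖ' : K} (hϖ' : ϖ' * ι ϖ = 1)
    (hK : ∀ κ : K, ∃ N : ℕ, ι ϖ ^ N * κ ∈ ι.range)
    {φ : O →+* O} [IsLocalHom φ] (hφ : φ ϖ = ϖ) {φK : K →+* K} (hφK : ∀ a, φK (ι a) = ι (φ a))
    {T : V →+ V} {T' : V' →+ V'} (hT : ∀ (a : K) y, T (a • y) = φK a • T y)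
    (hT' : ∀ (a : K) y, T' (a • y) = φK a • T' y) {n l n' l' : ℕ}
    (h : Λ.IsTwist ϖ (φ ^ l) T^[l] n) (h' : Λ'.IsTwist ϖ (φ ^ l') T'^[l'] n')
    (f : V →ₗ[K] V') (hf : ∀ x, T' (f x) = f (T x)) (hf0 : f ≠ 0) : n * l' = n' * l := by
  have hπ : φK (ι ϖ) = ι ϖ := by rw [hφK, hφ]
  have hl' := isLocalHom_pow φ l'
  have hmem : ∀ (m : ℕ), ∀ x ∈ Λ.sub, (scaledIterate (ι ϖ) n l T)^[m] x ∈ Λ.sub := by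
    have hm : Set.MapsTo (scaledIterate (ι ϖ) n l T) Λ.sub Λ.sub := h.mem
    exact fun m x hx => hm.iterate m hx
  have hmem' : ∀ (m : ℕ), ∀ x ∈ Λ'.sub, (scaledIterate (ι ϖ) n' l' T')^[m] x ∈ Λ'.sub := by
    have hm : Set.MapsTo (scaledIterate (ι ϖ) n' l' T') Λ'.sub Λ'.sub := h'.mem
    exact fun m x hx => hm.iterate m hx
  have hdiv : ∀ (m : ℕ), ∀ x ∈ Λ'.sub,
      (∃ z ∈ Λ'.sub, (scaledIterate (ι ϖ) n' l' T')^[m] x = ι ϖ • z) →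
        ∃ z ∈ Λ'.sub, x = ι ϖ • z := by
    intro m
    induction m with
    | zero => exact fun x _ hx => hx
    | succ m ih =>
      intro x hx hx'
      refine h'.exists_eq_smul hϖ' hϖ.maximalIdeal_eq x hx ?_
      rw [← scaledIterate_apply]
      exact ih _ (hmem' 1 x hx) hx'
  have hφι : ∀ (m : ℕ), ∀ s ∈ ι.range, (φK ^ m) s ∈ ι.range := by
    rintro m _ ⟨a, rfl⟩
    induction m with
    | zero => exact ⟨a, rfl⟩
    | succ m ih =>
      obtain ⟨b, hb⟩ := ih
      refine ⟨φ b, ?_⟩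
      rw [pow_succ', RingHom.mul_def, RingHom.comp_apply, ← hb, hφK]
  have hcomm : ∀ (m : ℕ) x, T'^[m] (f x) = f (T^[m] x) := fun m x =>
    (Function.Semiconj.iterate_right (f := f) (ga := T) (gb := T') (fun x => (hf x).symm) m x).symm
  -- The outer exponents l' and l are swapped so that both maps involve the l l'-th iterate of T,
  -- resp. T'. The exponents then compared are a = n l' and b = n' l.
  refine exponent_eq_of_lattice_hom (S := ι.range) (L := Λ.sub) (L' := Λ'.sub) (π := ι ϖ)
    (Ψ := (scaledIterate (ι ϖ) n l T)^[l']) (Ψ' := (scaledIterate (ι ϖ) n' l' T')^[l])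
    ⟨ϖ, rfl⟩ hϖ' f (fun g => Λ.eq_zero_of_forall_mem g) (Λ.exists_pow_smul_map_mem hK Λ' f)
    (Λ'.eq_zero_of_forall_pow hϖ hι) (hmem l') ?_ (hdiv l) (hmem' l) ?_ ?_ hf0
  · refine span_image_iterate (hφι l) (scaledIterate_smul hT n l) ?_ l'
    exact h.le_span hϖ'
  · intro x
    rw [iterate_scaledIterate hT' hπ, iterate_scaledIterate hT' hπ, iterate_smul hT',
      pow_apply_eq_self hπ, smul_comm]
  · intro x
    rw [iterate_scaledIterate hT' hπ, iterate_scaledIterate hT hπ, hcomm, map_smul,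
      smul_smul, smul_smul, mul_comm l' l, mul_comm (ι ϖ ^ (n * l'))]

end Lattice

lemma oneTmul_smul {R S : Type u} [CommRing R] [CommRing S] (f : R →+* S) (M : ModuleCat.{u} R)
    (a : R) (m : M) : oneTmul f M (a • m) = f a • oneTmul f M m :=
  ((ModuleCat.extendRestrictScalarsAdj f).unit.app M).hom.map_smul a m

lemma extendScalars_map_oneTmul {R S : Type u} [CommRing R] [CommRing S] (f : R →+* S)
    {M N : ModuleCat.{u} R} (g : M ⟶ N) (m : M) :
    ((ModuleCat.extendScalars f).map g).hom (oneTmul f M m) = oneTmul f N (g.hom m) :=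
  congr($((ModuleCat.extendRestrictScalarsAdj f).unit.naturality g).hom m).symm

/-! ### Stalks at ∞ as lattices, and morphisms on generic stalks -/

variable {k : Type u} [Field k] {X : PointedCurve k} {L : Type u} [Field L] [Algebra k L]

/-- The stalk at `∞` as a lattice in the generic stalk. -/
def stalkLattice {F : (X.CL L).Modules} {U : (X.CL L).Opens} {r : ℕ} {b : Fin r → Γ(F, U)}
    (hb : IsFrame b) (hU : X.inftyL L ∈ U) :
    Lattice (toGeneric X L) (F.presheaf.stalk (X.inftyL L)) (F.presheaf.stalk (eta X L)) where
  r := r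
  incl := stalkToGeneric X F
  incl_smul := stalkSpecializes_smul F (eta_specializes X L)
  basis := hb.stalkBasis hU
  basisK := hb.stalkBasis ((eta_specializes X L).mem_open U.isOpen hU)
  basisK_apply i := by
    rw [IsFrame.stalkBasis_apply, IsFrame.stalkBasis_apply]
    exact (stalkSpecializes_germSec F (eta_specializes X L) hU (b i)).symm

/-- The n-th power of the maximal ideal is generated by ϖ^n, so one multiplier suffices to test
membership. -/
lemma mem_twistedStalk_iff {F : (X.CL L).Modules} {U : (X.CL L).Opens} {r : ℕ}
    {b : Fin r → Γ(F, U)} (hb : IsFrame b) (hU : X.inftyL L ∈ U)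
    {ϖ : (X.CL L).presheaf.stalk (X.inftyL L)} (hϖ : Irreducible ϖ) (n : ℕ)
    (y : F.presheaf.stalk (eta X L)) :
    y ∈ twistedStalk X F n ↔ toGeneric X L ϖ ^ n • y ∈ (stalkLattice hb hU).sub := by
  constructor
  · intro h
    rw [← map_pow]
    refine h (ϖ ^ n) (Ideal.pow_mem_pow ?_ n)
    rw [hϖ.maximalIdeal_eq]
    exact Ideal.mem_span_singleton_self ϖ
  · intro h a ha
    rw [hϖ.maximalIdeal_eq, Ideal.span_singleton_pow, Ideal.mem_span_singleton] at ha
    obtain ⟨c, rfl⟩ := ha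
    rw [mul_comm, map_mul, map_pow, mul_smul]
    exact (stalkLattice hb hU).sub.smul_mem (⟨_, c, rfl⟩ : (toGeneric X L).range) h

section Extension

variable {M M' : ModuleCat.{u} (X.AL L)} {F F' : (X.CL L).Modules}
  {e : M ≃+ Γ(F, X.affinePartL L)} {e' : M' ≃+ Γ(F', X.affinePartL L)}

/-- The sections over an affine open are generated by the elements of the module. -/
lemma IsExtension.section_induction (h : IsExtension X M F e) {V : (X.CL L).Opens}
    (hV : V ≤ X.affinePartL L) (hVa : IsAffineOpen V) {p : Γ(F, V) → Prop} (h0 : p 0)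
    (hsmul : ∀ (a : Γ(X.CL L, V)) (m : M), p (a • resSec F hV (e m)))
    (hadd : ∀ x y, p x → p y → p (x + y)) (s : Γ(F, V)) : p s := by
  obtain ⟨θ, hθ⟩ := h.2 V hV hVa
  obtain ⟨u, rfl⟩ := θ.surjective s
  induction u using extendScalars_induction with
  | h0 => rwa [map_zero]
  | hsmul b x => rw [hθ]; exact hsmul b x
  | hadd x y hx hy => rw [map_add]; exact hadd _ _ hx hy

lemma IsExtension.exists_section_map (h : IsExtension X M F e) (h' : IsExtension X M' F' e')
    (f : M ⟶ M') {V : (X.CL L).Opens} (hV : V ≤ X.affinePartL L) (hVa : IsAffineOpen V) :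
    ∃ g : Γ(F, V) →ₗ[Γ(X.CL L, V)] Γ(F', V), ∀ m,
      g (resSec F hV (e m)) = resSec F' hV (e' (f.hom m)) := by
  obtain ⟨θ, hθ⟩ := h.2 V hV hVa
  obtain ⟨θ', hθ'⟩ := h'.2 V hV hVa
  have hone' : ∀ m, θ' (oneTmul (X.toSections V hV) M' m) = resSec F' hV (e' m) := fun m => by
    have := hθ' 1 m
    rwa [one_smul, one_smul] at this
  have hone : ∀ m, θ (oneTmul (X.toSections V hV) M m) = resSec F hV (e m) := fun m => by
    have := hθ 1 m
    rwa [one_smul, one_smul] at this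
  have hlin : ∀ (c : Γ(X.CL L, V)) u, θ (c • u) = c • θ u := by
    intro c u
    induction u using extendScalars_induction with
    | h0 => simp
    | hsmul b x => rw [smul_smul, hθ, hθ, mul_smul]
    | hadd x y hx hy => rw [smul_add, map_add, map_add, hx, hy, smul_add]
  obtain ⟨G, hG⟩ := exists_extendScalars_lift (X.toSections V hV) (M := M)
    (N := ModuleCat.of Γ(X.CL L, V) Γ(F', V))
    (((resSec F' hV).comp e'.toAddMonoidHom).comp f.hom.toAddMonoidHom) (fun a m => by
      change resSec F' hV (e' (f.hom (a • m))) = X.toSections V hV a • resSec F' hV (e' (f.hom m))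
      rw [← hone', map_smul, oneTmul_smul, hθ'])
  let θl : (ModuleCat.extendScalars (X.toSections V hV)).obj M ≃ₗ[Γ(X.CL L, V)] Γ(F, V) :=
    { θ with map_smul' := hlin }
  refine ⟨G ∘ₗ θl.symm.toLinearMap, fun m => ?_⟩
  have h1 : θl.symm (resSec F hV (e m)) = oneTmul (X.toSections V hV) M m := by
    rw [LinearEquiv.symm_apply_eq]
    exact (hone m).symm
  exact (congrArg G h1).trans (hG m)

/-- A homomorphism of modules induces a map of the generic stalks of their extensions. -/
lemma IsExtension.exists_generic_map (h : IsExtension X M F e) (h' : IsExtension X M' F' e')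
    {r : ℕ} (hF : IsLocallyFreeOfRank F r) (hη : eta X L ∈ X.affinePartL L) (f : M ⟶ M') :
    (∃ g : F.presheaf.stalk (eta X L) →ₗ[(X.CL L).presheaf.stalk (eta X L)]
        F'.presheaf.stalk (eta X L), ∀ m,
      g (germSec F hη (e m)) = germSec F' hη (e' (f.hom m))) ∧
    Submodule.span ((X.CL L).presheaf.stalk (eta X L)) (Set.range fun m => germSec F hη (e m)) =
      ⊤ := by
  obtain ⟨W, hW, b, hb⟩ := hF.exists_frame (eta X L)
  obtain ⟨_, ⟨V, hVa, rfl⟩, hηV, hVle⟩ := (X.CL L).isBasis_affineOpens.exists_subset_of_mem_open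
    (show eta X L ∈ (W ⊓ X.affinePartL L : (X.CL L).Opens) from ⟨hW, hη⟩)
    (W ⊓ X.affinePartL L).isOpen
  have hVW : V ≤ W := fun x hx => (hVle hx).1
  have hV : V ≤ X.affinePartL L := fun x hx => (hVle hx).2
  have hb' := hb.res hVW
  constructor
  · obtain ⟨g, hg⟩ := h.exists_section_map h' f hV hVa
    -- A frame near η gives a basis of the generic stalk; the map is prescribed there by the germs
    -- of the images under g.
    let gη := (hb'.stalkBasis hηV).constr ((X.CL L).presheaf.stalk (eta X L))
      fun j => germSec F' hηV (g (resSec F hVW (b j)))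
    have key : ∀ s, gη (germSec F hηV s) = germSec F' hηV (g s) := by
      intro s
      obtain ⟨a, rfl⟩ := hb'.exists_eq_sum s
      simp only [map_sum, map_smul, germSec_smul, ← hb'.stalkBasis_apply hηV]
      refine Finset.sum_congr rfl fun j _ => ?_
      congr 1
      exact (hb'.stalkBasis hηV).constr_basis _ _ j
    refine ⟨gη, fun m => ?_⟩
    rw [← germSec_res F hV hηV, key, hg, germSec_res]
  · rw [eq_top_iff, ← (hb'.stalkBasis hηV).span_eq, Submodule.span_le]
    rintro _ ⟨j, rfl⟩
    rw [hb'.stalkBasis_apply]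
    refine h.section_induction hV hVa (p := fun s => germSec F hηV s ∈
      Submodule.span ((X.CL L).presheaf.stalk (eta X L))
        (Set.range fun m => germSec F hη (e m))) ?_ ?_ ?_ _
    · rw [map_zero]; exact zero_mem _
    · intro a m
      rw [germSec_smul, germSec_res]
      exact Submodule.smul_mem _ _ (Submodule.subset_span ⟨m, rfl⟩)
    · intro x y hx hy
      rw [map_add]
      exact add_mem hx hy

end Extension

/-! ### Pure A-motives: proportionality of the purity exponents -/

variable [Finite k]

lemma semilin_comp {M M' : ModuleCat.{u} (X.AL L)}
    {τ : (ModuleCat.extendScalars (X.σA L)).obj M ⟶ M}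
    {τ' : (ModuleCat.extendScalars (X.σA L)).obj M' ⟶ M'} {f : M ⟶ M'}
    (h : τ ≫ f = (ModuleCat.extendScalars (X.σA L)).map f ≫ τ') (m : M) :
    f.hom (semilin X τ m) = semilin X τ' (f.hom m) := by
  have h1 := congr($(h).hom (oneTmul (X.σA L) M m))
  rw [ModuleCat.hom_comp, ModuleCat.hom_comp, LinearMap.comp_apply, LinearMap.comp_apply,
    extendScalars_map_oneTmul] at h1
  exact h1

/-- A nonzero morphism forces the exponents in the purity conditions to be proportional. -/
theorem IsPurePair.mul_eq_mul {M M' : ModuleCat.{u} (X.AL L)}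
    {τ : (ModuleCat.extendScalars (X.σA L)).obj M ⟶ M}
    {τ' : (ModuleCat.extendScalars (X.σA L)).obj M' ⟶ M'} {r n l r' n' l' : ℕ}
    (hM : IsPurePair X M τ r n l) (hM' : IsPurePair X M' τ' r' n' l') {f : M ⟶ M'}
    (hf : τ ≫ f = (ModuleCat.extendScalars (X.σA L)).map f ≫ τ') (hf0 : f ≠ 0) :
    n * l' = n' * l := by
  obtain ⟨-, -, F, e, hF, hext, T, hT, hTτ, θ, hθ⟩ := hM
  obtain ⟨-, -, F', e', hF', hext', T', hT', hTτ', θ', hθ'⟩ := hM'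
  obtain ⟨m, hm⟩ : ∃ m, f.hom m ≠ 0 := by
    by_contra! hcon
    exact hf0 (ModuleCat.hom_ext (LinearMap.ext hcon))
  -- The nonzero section also shows that η lies in C_L ∖ {∞}: otherwise the vanishing criterion
  -- would hold vacuously and force it to be 0.
  obtain ⟨hη, hmη⟩ : ∃ hη : eta X L ∈ X.affinePartL L, germSec F' hη (e' (f.hom m)) ≠ 0 := by
    by_contra! hcon
    exact hm ((map_eq_zero_iff e' e'.injective).1 (eq_zero_of_germSec_genericPoint hF' _ hcon))
  obtain ⟨⟨g, hg⟩, hspan⟩ := hext.exists_generic_map hext' hF hη f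
  have hg0 : g ≠ 0 := by
    rintro rfl
    exact hmη (hg m).symm
  -- Both sides are semilinear for the same endomorphism of the function field, so it suffices to
  -- compare them on germs of elements of M, which span the generic stalk.
  have hcomm : ∀ y, T' (g y) = g (T y) := by
    intro y
    have hy : y ∈ Submodule.span ((X.CL L).presheaf.stalk (eta X L))
        (Set.range fun m => germSec F hη (e m)) := by rw [hspan]; trivial
    induction hy using Submodule.span_induction with
    | mem y hy =>
      obtain ⟨m, rfl⟩ := hy
      rw [hg]
      refine (hTτ' hη _).trans ?_
      rw [← semilin_comp hf]
      exact (hg _).symm.trans (congrArg g (hTτ hη m).symm)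
    | zero => simp
    | add x y _ _ hx hy => simp only [map_add, hx, hy]
    | smul a y _ hy => rw [map_smul, hT', hT, map_smul, hy]
  obtain ⟨t⟩ := X.nonempty_uniformizer L
  obtain ⟨U, hU, b, hb⟩ := hF.exists_frame (X.inftyL L)
  obtain ⟨U', hU', b', hb'⟩ := hF'.exists_frame (X.inftyL L)
  have hϖ0 : toGeneric X L t.germ ≠ 0 :=
    (map_ne_zero_iff _ X.toGeneric_injective).2 t.germ_irreducible.ne_zero
  exact Lattice.slope_eq (Λ := stalkLattice hb hU) (Λ' := stalkLattice hb' hU')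
    X.toGeneric_injective t.germ_irreducible (inv_mul_cancel₀ hϖ0)
    (X.exists_pow_mul_mem_range t.germ_irreducible) t.stalkEndo_germ
    (fun a => (X.toGeneric_stalkEndo a).symm) hT hT'
    ⟨_, θ, mem_twistedStalk_iff hb hU t.germ_irreducible n, hθ⟩
    ⟨_, θ', mem_twistedStalk_iff hb' hU' t.germ_irreducible n', hθ'⟩ g hcomm hg0

theorem PureAMotive.Hom.map_eq_zero {c : X.A →ₐ[k] L} {r d r' d' : ℕ} {N : PureAMotive X c r d}
    {N' : PureAMotive X c r' d'} {w w' : ℚ} (hw : N.IsWeight w) (hw' : N'.IsWeight w')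
    (h : w ≠ w') (f : N.Hom N') : f.map = 0 := by
  obtain ⟨n, l, hN, rfl⟩ := hw
  obtain ⟨n', l', hN', rfl⟩ := hw'
  by_contra hf
  refine h ?_
  have hl : (l : ℚ) ≠ 0 := Nat.cast_ne_zero.2 hN.2.1.ne'
  have hl' : (l' : ℚ) ≠ 0 := Nat.cast_ne_zero.2 hN'.2.1.ne'
  rw [div_eq_div_iff hl hl']
  exact_mod_cast hN.mul_eq_mul hN' f.comm hf

end PureMotive

end

theorem mainTheorem3 {k L : Type u} [Field k] [Finite k] [Field L] [Algebra k L]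
    (X : PureMotive.PointedCurve k) :
    (∀ (c : X.A →ₐ[k] L) (r d r' d' : ℕ)
      (N : PureMotive.PureAMotive X c r d) (N' : PureMotive.PureAMotive X c r' d') (w w' : ℚ),
      N.IsWeight w → N'.IsWeight w' → w ≠ w' →
        ∀ f : PureMotive.PureAMotive.Hom N N', f.map = 0) ∧
    (∀ (c : Spec (.of L) ⟶ X.C)
      (hc : c ≫ X.π = Spec.map (CommRingCat.ofHom (algebraMap k L))) (r d r' d' : ℕ)
      (S : PureMotive.AbelianTauSheaf X c hc r d) (S' : PureMotive.AbelianTauSheaf X c hc r' d'),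
      (∃ f : PureMotive.AbelianTauSheaf.Hom S S', ∃ i, f.map i ≠ 0) → S.weight = S'.weight) :=
  ⟨fun _ _ _ _ _ _ _ _ _ hw hw' h f => f.map_eq_zero hw hw' h,
    fun _ _ _ _ _ _ _ _ ⟨f, _, hf⟩ => PureMotive.AbelianTauSheaf.weight_eq_of_hom_ne_zero f hf⟩
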